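/- Let $B$ be $\mathbb{C}$ (case A), $\mathbb{R}$ (case B) or $\mathbb{H}$ (case C), with its standard conjugation (trivial for $B=\mathbb{R}$). Let $V=B^n$ be a right $B$-space with a non-degenerate skew Hermitian form $(v,w)=v^*Hw$, and let $G$ be its isometry group, i.e. $\mathrm{U}(p,q)$ with $(p,q)$ the signature of $i(\,,)$, resp. $\mathrm{Sp}(n,\mathbb{R})$ ($n$ even), resp. $\mathrm{O}^*(2n)$. Let $D$ be the symmetric space of $G$: its points are the negative planes $z$ for $i(\,,)$ (Lagrangian negative planes in the complexification of $V$ in case B, resp. in the complex space underlying $V$ in case C). With $\theta_z=-1$ on $z$ and $\theta_z=+1$ on $z^\perp$, and $I_z=i\theta_z$ (equivalently: $I_z$ is an isometry of $V$ with $I_z^2=-1$ and $(v,I_zv)$ positive definite), the majorant is $\|v\|_z^2=i(v,\theta_z v)=(v,I_zv)$. Identify $T_zD$ with $\mathfrak{p}_z$, the $-1$ eigenspace of $\mathrm{Ad}(I_z)$ on $\mathfrak{g}_0=\mathrm{Lie}(G)$, give $D$ the $G$-invariant Riemannian metric defined by the trace form $\mathrm{Re}\,\mathrm{tr}(XY)$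 on $\mathfrak{p}_z$, and let $d$ be the Riemannian distance. For a non-degenerate subspace $W\subseteq V$ let $D(W)$ be the symmetric space of the isometry group of $W$. Let ${\bf x}=(x_1,\dots,x_m)\in V^m$ be such that $U=\mathrm{span}_B\{{\bf x}\}$ is non-degenerate, let $z'\in D(U)$, and put $D_{U,z'}=\{z'\oplus w\mid w\in D(U^\perp)\}\subseteq D$. Let $W=B^{2m}$ be a left $B$-space with basis $e_1,\dots,e_m,f_1,\dots,f_m$ and the split Hermitian form $\langle e_a,f_b\rangle=\delta_{ab}$, $\langle e_a,e_b\rangle=\langle f_a,f_b\rangle=0$, and let $G'$ be its isometry group ($\mathrm{U}(m,m)$, $\mathrm{O}(m,m)$, $\mathrm{Sp}(m,m)$). Let $\tilde G'$ be the inverse image of $G'$ in the metaplectic group $\mathrm{Mp}(\mathbb{W})$ of the symplectic space $\mathbb{W}=V\otimes_BW$ with form $\langle\langle v\otimes w,\tilde v\otimes\tilde w\rangle\rangle=\mathrm{Re}\big((v,\tilde v)\langle\tilde w,w\rangle\big)$, and let $\omega$ be the Weil representation of $\tilde G'$ in the Schr\"odinger model $\mathcal{S}(V^m)$, $V^m=\bigoplus_a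 V\otimes e_a$: it is unitary and satisfies $\omega(g')\rho(w)\omega(g')^{-1}=\rho(g'\cdot w)$ for $w\in\mathbb{W}$, where $v\otimes e_a$ acts under $\rho$ by the directional derivative and $v\otimes f_a$ by multiplication with $2\pi i\langle\langle\,\cdot\,,v\otimes f_a\rangle\rangle$. The group $G$ acts on $\mathcal{S}(V^m)$ by $(\omega(g)\varphi)({\bf y})=\varphi(g^{-1}{\bf y})$. (1) If $U\neq 0$, there are constants $b,c>0$, depending on ${\bf x}$ and $z'$, such that for all $z_0\in D_{U,z'}$ and all $z\in D$ $$M_{z_0}(z,{\bf x}):=\sum_{l=1}^m\|g_z^{-1}x_l\|_{z_0}^2\ \ge\ c\,\exp\big(2b\cdot d(D_{U,z'},z)\big),$$ where $g_z$ is any element of $G$ with $g_zz_0=z$. (2) Let $z_0\in D$, let $K\subseteq G$ be its stabiliser, let $\mathfrak{p}$ be the complexification of $\mathfrak{p}_{z_0}$, and let $\psi\in(\bigwedge^\bullet\mathfrak{p}^*\otimes\mathcal{S}(V^m))^K$. For $z\in D$, $g'\in\tilde G'$ and $g_z\in G$ with $g_zz_0=z$ put $$\tilde\psi(z,g',{\bf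 x})=L_{g_z^{-1}}^*\big(\omega(g_z)\,\omega(g')\,\psi({\bf x})\big)\in\textstyle\bigwedge^\bullet T_z^*D\otimes\mathbb{C}.$$ Then for every real $\rho>0$ there is a continuous function $g'\mapsto C'_\rho(g')>0$ on $\tilde G'$ such that for all $g'\in\tilde G'$ and all $z\in D$ $$\|\tilde\psi(z,g',{\bf x})\|\ \le\ C'_\rho(g')\,\exp\big(-\rho\cdot d(D_{U,z'},z)\big),$$ where the norm is the one induced by the Riemannian metric of $D$. -/

import Mathlib

open scoped Matrix SchwartzMap Quaternion

namespace CycleDecay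

/-! ## The three base algebras -/

/-- The real part `B → ℝ` of a real division algebra with involution. -/
class RealPart (B : Type) [NormedDivisionRing B] [NormedAlgebra ℝ B] where
  /-- the real part, as a real linear map -/
  re : B →ₗ[ℝ] ℝ

noncomputable instance : RealPart ℂ := ⟨Complex.reLm⟩
noncomputable instance : RealPart ℝ := ⟨LinearMap.id⟩
noncomputable instance : RealPart ℍ[ℝ] := ⟨QuaternionAlgebra.reₗ (-1 : ℝ) 0 (-1)⟩

instance : StarModule ℝ ℍ[ℝ] := ⟨fun r a => by ext <;> simp⟩

instance : FiniteDimensional ℝ ℍ[ℝ] :=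
  Module.Finite.of_basis (QuaternionAlgebra.basisOneIJK (-1 : ℝ) 0 (-1))

/-- `B`, with its norm, conjugation `star` and real part, is one of
`ℂ` (case A), `ℝ` (case B, trivial conjugation), `ℍ` (case C). -/
inductive IsBase : ∀ (B : Type) [NormedDivisionRing B] [NormedAlgebra ℝ B] [StarRing B]
    [RealPart B], Prop
  | caseA : IsBase ℂ
  | caseB : IsBase ℝ
  | caseC : IsBase ℍ[ℝ]

variable {B : Type} [NormedDivisionRing B] [NormedAlgebra ℝ B] [StarRing B] [StarModule ℝ B]
  [FiniteDimensional ℝ B] [RealPart B] {n m : ℕ}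

/-! ## The skew Hermitian space `V = Bⁿ`, a right `B`-module, and its isometry group -/

/-- The form `(v, w) = v* H w` on the right `B`-module `Bⁿ`, so that
`(v b, w c) = b* (v, w) c`.  It is skew Hermitian if `H* = -H`. -/
noncomputable def form (H : Matrix (Fin n) (Fin n) B) (v w : Fin n → B) : B := star v ⬝ᵥ (H *ᵥ w)

/-- The isometry group of `(Bⁿ, ( , ))`, as a group of matrices: `U(p,q)`, where `(p,q)` is the
signature of `i( , )`, if `B = ℂ`; `Sp(n, ℝ)` (with `n` even) if `B = ℝ`; `O*(2n)` if `B = ℍ`. -/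
def isometryGroup (H : Matrix (Fin n) (Fin n) B) : Subgroup (Matrix (Fin n) (Fin n) B)ˣ where
  carrier := {g | (g : Matrix (Fin n) (Fin n) B)ᴴ * H * (g : Matrix (Fin n) (Fin n) B) = H}
  one_mem' := by simp
  mul_mem' := by
    intro a b ha hb
    simp only [Set.mem_ofPred_eq, Units.val_mul, Matrix.conjTranspose_mul] at *
    calc _ = (b : Matrix (Fin n) (Fin n) B)ᴴ * ((a : Matrix (Fin n) (Fin n) B)ᴴ * H * a) * b := by
          simp only [mul_assoc]
      _ = H := by rw [ha, hb]
  inv_mem' := by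
    intro a ha
    simp only [Set.mem_ofPred_eq] at *
    have h1 : ((a⁻¹ : (Matrix (Fin n) (Fin n) B)ˣ) : Matrix (Fin n) (Fin n) B)ᴴ
        * (a : Matrix (Fin n) (Fin n) B)ᴴ = 1 := by
      rw [← Matrix.conjTranspose_mul, Units.mul_inv, Matrix.conjTranspose_one]
    conv_lhs => rw [← ha]
    simp only [← mul_assoc]
    rw [h1, one_mul, mul_assoc, Units.mul_inv, mul_one]

/-! ## The symmetric spaces

A point `z` of the symmetric space of the isometry group of a skew Hermitian space `(M, φ)` is
recorded through the operator `I = i θ_z`, where `θ_z` is the involution `-1` on `z`, `+1` on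
`z^⊥`.  This is the element of the isometry group, central in the stabiliser of `z`, whose
conjugation action is the Cartan involution belonging to `z`, and `φ(x, I x) = i φ(x, θ_z x)` is
the majorant.  For `B = ℂ` the negative plane is `z = ker (I + i)`; for `B = ℝ` the Lagrangian
negative plane is `z = ker (I + i)` in `M ⊗ ℂ`; for `B = ℍ` it is `z = {v | I v = - v i}`.
Conversely every isometry `I` with `I² = -1` and `φ(x, I x)` positive definite arises from exactly
one such plane. -/

/-- The symmetric space of the isometry group of a right `B`-module with a skew Hermitian form. -/
noncomputable def complexStructures {M : Type} [AddCommGroup M] [Module Bᵐᵒᵖ M] (φ : M → M → B) :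
    Set (M →ₗ[Bᵐᵒᵖ] M) :=
  {I | (∀ v, I (I v) = -v) ∧ (∀ v w, φ (I v) (I w) = φ v w) ∧
    ∀ v, v ≠ 0 → 0 < RealPart.re (φ v (I v))}

/-- The symmetric space `D` of the isometry group of `(Bⁿ, ( , ))`, with operators written as
matrices. -/
noncomputable def symmetricSpace (H : Matrix (Fin n) (Fin n) B) : Set (Matrix (Fin n) (Fin n) B) :=
  {I | I * I = -1 ∧ Iᴴ * H * I = H ∧ ∀ v, v ≠ 0 → 0 < RealPart.re (form H v (I *ᵥ v))}

/-- The action of the isometry group on `D`: `I_{g z} = g I_z g⁻¹`. -/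
def act (g : (Matrix (Fin n) (Fin n) B)ˣ) (z : Matrix (Fin n) (Fin n) B) :
    Matrix (Fin n) (Fin n) B :=
  g * z * (g⁻¹ : (Matrix (Fin n) (Fin n) B)ˣ)

/-- The square `‖v‖²_z = (v, v)_z = (v, I_z v)` of the norm given by the majorant of `( , )` with
respect to `z`. -/
noncomputable def majorant (H z : Matrix (Fin n) (Fin n) B) (v : Fin n → B) : ℝ :=
  RealPart.re (form H v (z *ᵥ v))

/-- The action of `g` on `V^m`. -/
def actTuple (g : (Matrix (Fin n) (Fin n) B)ˣ) (x : Fin m → Fin n → B) : Fin m → Fin n → B :=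
  fun l => (g : Matrix (Fin n) (Fin n) B) *ᵥ x l

/-- The tangent space of `D` at `z`, identified with `𝔭_z`, the `-1` eigenspace of the Cartan
involution `X ↦ I_z X I_z⁻¹` on the Lie algebra of the isometry group. -/
noncomputable def tangent (H z : Matrix (Fin n) (Fin n) B) : Submodule ℝ (Matrix (Fin n) (Fin n) B) where
  carrier := {X | Xᴴ * H + H * X = 0 ∧ X * z = -(z * X)}
  zero_mem' := by simp
  add_mem' := by
    rintro X Y ⟨hX, hX'⟩ ⟨hY, hY'⟩
    refine ⟨?_, ?_⟩
    · rw [Matrix.conjTranspose_add, add_mul, mul_add, add_add_add_comm, hX, hY, add_zero]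
    · rw [add_mul, mul_add, hX', hY', neg_add]
  smul_mem' := by
    rintro r X ⟨hX, hX'⟩
    refine ⟨?_, ?_⟩
    · rw [Matrix.conjTranspose_smul, star_trivial, Matrix.smul_mul, Matrix.mul_smul, ← smul_add,
        hX, smul_zero]
    · rw [Matrix.smul_mul, Matrix.mul_smul, hX', smul_neg]

/-- The trace form, whose restriction to every `𝔭_z` is the invariant Riemannian metric of `D`. -/
noncomputable def traceForm (X Y : Matrix (Fin n) (Fin n) B) : ℝ := RealPart.re (Matrix.trace (X * Y))

/-- The velocity of a curve `t ↦ γ(t)` in `D` as an element of `𝔭_{γ(t)}`: the tangent vector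
`X ∈ 𝔭_z` is the derivative of `exp(sX) z exp(-sX)` at `s = 0`, which is `X z - z X = 2 X z`;
so `X = (1/2) γ' γ⁻¹ = -(1/2) γ' γ`. -/
noncomputable def velocity (γ : ℝ → Matrix (Fin n) (Fin n) B) (t : ℝ) :
    Matrix (Fin n) (Fin n) B :=
  (-(1 / 2 : ℝ)) • (Matrix.of (fun i j => deriv (fun s => γ s i j) t) * γ t)

/-- The Riemannian distance of `z ∈ D` from a subset `A` of `D`: the infimum of the lengths of the
continuously differentiable curves in `D` from a point of `A` to `z`. -/
noncomputable def riemDist (H : Matrix (Fin n) (Fin n) B) (A : Set (Matrix (Fin n) (Fin n) B))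
    (z : Matrix (Fin n) (Fin n) B) : ℝ :=
  sInf {ℓ | ∃ γ : ℝ → Matrix (Fin n) (Fin n) B,
    (∀ i j, ContDiff ℝ 1 (fun t => γ t i j)) ∧
    (∀ t ∈ Set.Icc (0 : ℝ) 1, γ t ∈ symmetricSpace H) ∧ γ 0 ∈ A ∧ γ 1 = z ∧
    ℓ = ∫ t in (0 : ℝ)..1, Real.sqrt (traceForm (velocity γ t) (velocity γ t))}

/-! ## Generalized special subsymmetric spaces -/

/-- The form restricted to a `B`-subspace of `V`. -/
noncomputable def restrictForm (H : Matrix (Fin n) (Fin n) B) (W : Submodule Bᵐᵒᵖ (Fin n → B)) (v w : W) : B :=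
  form H v w

/-- `U` is non-degenerate with respect to `( , )`. -/
def Nondegenerate (H : Matrix (Fin n) (Fin n) B) (U : Submodule Bᵐᵒᵖ (Fin n → B)) : Prop :=
  ∀ u ∈ U, (∀ w ∈ U, form H u w = 0) → u = 0

/-- The orthogonal complement `U^⊥`. -/
def orthogonal (H : Matrix (Fin n) (Fin n) B) (U : Submodule Bᵐᵒᵖ (Fin n → B)) :
    Submodule Bᵐᵒᵖ (Fin n → B) where
  carrier := {v | ∀ u ∈ U, form H u v = 0}
  zero_mem' := by intro u _; simp [form]
  add_mem' := by
    intro v w hv hw u hu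
    have h1 := hv u hu
    have h2 := hw u hu
    simp only [form] at *
    rw [Matrix.mulVec_add, dotProduct_add, h1, h2, add_zero]
  smul_mem' := by
    intro b v hv u hu
    have h1 := hv u hu
    simp only [form] at *
    rw [Matrix.mulVec_smul, dotProduct_smul, h1, smul_zero]

/-- `D(W)`, the symmetric space of the isometry group of a `B`-subspace `W` of `V`
(for `W` non-degenerate, `G(W)` is that group). -/
noncomputable def subspaceSymmetricSpace (H : Matrix (Fin n) (Fin n) B) (W : Submodule Bᵐᵒᵖ (Fin n → B)) :
    Set (W →ₗ[Bᵐᵒᵖ] W) :=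
  complexStructures (restrictForm H W)

/-- `D_{U,z'} = {z' ⊕ w | w ∈ D(U^⊥)}`, a subset of `D`. -/
noncomputable def specialSubspace (H : Matrix (Fin n) (Fin n) B) (U : Submodule Bᵐᵒᵖ (Fin n → B))
    (z' : U →ₗ[Bᵐᵒᵖ] U) : Set (Matrix (Fin n) (Fin n) B) :=
  {z | z ∈ symmetricSpace H ∧ ∃ w ∈ subspaceSymmetricSpace H (orthogonal H U),
    (∀ u : U, z *ᵥ (u : Fin n → B) = (z' u : Fin n → B)) ∧
    ∀ v : orthogonal H U, z *ᵥ (v : Fin n → B) = (w v : Fin n → B)}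

/-! ## The Weil representation of the metaplectic group on `𝓢(V^m)` -/

/-- `Σ_l Re (x_l, y_l)`. -/
noncomputable def pairing (H : Matrix (Fin n) (Fin n) B) (x y : Fin m → Fin n → B) : ℝ :=
  ∑ l, RealPart.re (form H (x l) (y l))

/-- `𝕎 = V ⊗_B W = V^{2m}`, where `W = B^{2m}` has a basis `e_1, …, e_m, f_1, …, f_m` with
`<e_a, f_b> = δ_{ab}` and `<e_a, e_b> = <f_a, f_b> = 0`. -/
abbrev BigSpace (B : Type) (n m : ℕ) : Type := Fin m ⊕ Fin m → Fin n → B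

/-- The component of `w ∈ 𝕎` in `𝕏 = V ⊗ span(e_a) = V^m`. -/
def xPart (w : BigSpace B n m) : Fin m → Fin n → B := fun l => w (Sum.inl l)

/-- The component of `w ∈ 𝕎` in `𝕐 = V ⊗ span(f_a) = V^m`. -/
def yPart (w : BigSpace B n m) : Fin m → Fin n → B := fun l => w (Sum.inr l)

/-- The symplectic form `⟨⟨v ⊗ w, v' ⊗ w'⟩⟩ = Re ((v, v') <w', w>)` on `𝕎`. -/
noncomputable def symplecticForm (H : Matrix (Fin n) (Fin n) B) (w w' : BigSpace B n m) : ℝ :=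
  pairing H (xPart w) (yPart w') + pairing H (yPart w) (xPart w')

/-- `x ↦ ⟨⟨x, y⟩⟩` for `x ∈ 𝕏`, `y ∈ 𝕐`, as a continuous linear functional. -/
noncomputable def pairingCLM (H : Matrix (Fin n) (Fin n) B) (y : Fin m → Fin n → B) :
    (Fin m → Fin n → B) →L[ℝ] ℝ :=
  LinearMap.toContinuousLinearMap
    { toFun := fun x => pairing H x y
      map_add' := by
        intro x x'
        simp [pairing, form, add_dotProduct, Finset.sum_add_distrib]
      map_smul' := by
        intro r x
        simp only [pairing, form, Pi.smul_apply, star_smul, star_trivial, smul_dotProduct,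
          map_smul, Finset.smul_sum, RingHom.id_apply] }

/-- The action of `w = x₀ + y₀ ∈ 𝕏 ⊕ 𝕐` on `𝓢(𝕏)` through the Weyl algebra with parameter
`λ = 2πi`: `x₀` acts by the directional derivative and `y₀` by multiplication with
`2πi ⟨⟨x, y₀⟩⟩`. -/
noncomputable def weylOp (H : Matrix (Fin n) (Fin n) B) (w : BigSpace B n m) :
    𝓢(Fin m → Fin n → B, ℂ) →L[ℂ] 𝓢(Fin m → Fin n → B, ℂ) :=
  LineDeriv.lineDerivOpCLM ℂ 𝓢(Fin m → Fin n → B, ℂ) (xPart w) +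
    (2 * Real.pi * Complex.I : ℂ) •
      SchwartzMap.smulLeftCLM ℂ (fun x => (pairingCLM H (yPart w) x : ℂ))

theorem weylOp_apply (H : Matrix (Fin n) (Fin n) B) (w : BigSpace B n m)
    (f : 𝓢(Fin m → Fin n → B, ℂ)) (x : Fin m → Fin n → B) :
    weylOp H w f x = fderiv ℝ f x (xPart w) +
      2 * Real.pi * Complex.I * (pairing H x (yPart w) : ℂ) * f x := by
  have h : Function.HasTemperateGrowth (fun x => (pairingCLM H (yPart w) x : ℂ)) :=
    (Complex.ofRealCLM.comp (pairingCLM H (yPart w))).hasTemperateGrowth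
  simp only [weylOp, add_apply, smul_apply, LineDeriv.lineDerivOpCLM_apply,
    SchwartzMap.lineDerivOp_apply_eq_fderiv, SchwartzMap.smulLeftCLM_apply_apply h, smul_eq_mul,
    mul_assoc]
  rfl

/-- The `L²` inner product of Schwartz functions on a finite dimensional real normed space, for a
Haar (Lebesgue) measure. -/
noncomputable def l2Inner {E : Type} [NormedAddCommGroup E] [NormedSpace ℝ E]
    [FiniteDimensional ℝ E] (f g : 𝓢(E, ℂ)) : ℂ :=
  letI : MeasurableSpace E := borel E
  haveI : BorelSpace E := ⟨rfl⟩
  haveI : ProperSpace E := FiniteDimensional.proper_real E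
  ∫ x, star (f x) * g x ∂(MeasureTheory.Measure.addHaar : MeasureTheory.Measure E)

/-- The group of pairs `(γ, T)`, with `γ ∈ Sp(𝕎)` and `T` a unitary automorphism of the
Schrödinger model `𝓢(𝕏)` such that `T ρ(w) T⁻¹ = ρ(γ w)` for `w ∈ 𝕎`.  For each `γ` the operator
`T` is unique up to a scalar of absolute value one, so this is an extension of `Sp(𝕎)` by the
circle. -/
noncomputable def metaplecticCircle (H : Matrix (Fin n) (Fin n) B) (m : ℕ) :
    Subgroup ((BigSpace B n m ≃ₗ[ℝ] BigSpace B n m) ×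
      (𝓢(Fin m → Fin n → B, ℂ) ≃L[ℂ] 𝓢(Fin m → Fin n → B, ℂ))) where
  carrier := {p | (∀ w w', symplecticForm H (p.1 w) (p.1 w') = symplecticForm H w w') ∧
    (∀ f f', l2Inner (p.2 f) (p.2 f') = l2Inner f f') ∧
    ∀ w f, p.2 (weylOp H w f) = weylOp H (p.1 w) (p.2 f)}
  one_mem' := ⟨fun _ _ => rfl, fun _ _ => rfl, fun _ _ => rfl⟩
  mul_mem' := by
    rintro p q ⟨h1, h2, h3⟩ ⟨k1, k2, k3⟩
    refine ⟨fun w w' => (h1 _ _).trans (k1 w w'), fun f f' => (h2 _ _).trans (k2 f f'),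
      fun w f => ?_⟩
    change p.2 (q.2 (weylOp H w f)) = weylOp H (p.1 (q.1 w)) (p.2 (q.2 f))
    rw [k3, h3]
  inv_mem' := by
    rintro p ⟨h1, h2, h3⟩
    have e1 : ∀ w, p.1 (p.1.symm w) = w := p.1.apply_symm_apply
    have e2 : ∀ f, p.2 (p.2.symm f) = f := p.2.apply_symm_apply
    refine ⟨fun w w' => ?_, fun f f' => ?_, fun w f => ?_⟩
    · change symplecticForm H (p.1.symm w) (p.1.symm w') = _
      rw [← h1, e1, e1]
    · change l2Inner (p.2.symm f) (p.2.symm f') = _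
      rw [← h2, e2, e2]
    · change p.2.symm (weylOp H w f) = weylOp H (p.1.symm w) (p.2.symm f)
      apply p.2.injective
      rw [e2, h3, e1, e2]

/-- The metaplectic group `Mp(𝕎)`, the two-fold cover of `Sp(𝕎)` (for `𝕎 ≠ 0`): it is the commutator subgroup
of the extension by the circle. -/
noncomputable def metaplectic (H : Matrix (Fin n) (Fin n) B) (m : ℕ) :
    Subgroup ((BigSpace B n m ≃ₗ[ℝ] BigSpace B n m) ×
      (𝓢(Fin m → Fin n → B, ℂ) ≃L[ℂ] 𝓢(Fin m → Fin n → B, ℂ))) :=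
  ⁅metaplecticCircle H m, metaplecticCircle H m⁆

/-- The Gram matrix of the split Hermitian form `< , >` on `W = B^{2m}`. -/
def splitGram (B : Type) [NormedDivisionRing B] (m : ℕ) :
    Matrix (Fin m ⊕ Fin m) (Fin m ⊕ Fin m) B :=
  Matrix.fromBlocks 0 1 1 0

/-- Right multiplication of `w ∈ 𝕎 = V ⊗_B W` by a `B`-linear transformation of the left
`B`-space `W`. -/
def rightMul (w : BigSpace B n m) (A : Matrix (Fin m ⊕ Fin m) (Fin m ⊕ Fin m) B) :
    BigSpace B n m :=
  fun k i => ∑ l, w l i * A l k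

/-- `g' ∈ G'`, the isometry group of the split Hermitian form on `W` (acting from the right):
`U(m,m)`, `O(m,m)`, `Sp(m,m)` for `B = ℂ`, `ℝ`, `ℍ`. -/
def IsDualIsometry (A : Matrix (Fin m ⊕ Fin m) (Fin m ⊕ Fin m) B) : Prop :=
  A * splitGram B m * Aᴴ = splitGram B m

/-- The group `G̃'`: the inverse image in `Mp(𝕎)` of `G'`, where `g' ∈ G'` acts on `𝕎` by
`w ↦ w g'⁻¹`. -/
def DualCover (H : Matrix (Fin n) (Fin n) B) (m : ℕ) : Type :=
  {p : (BigSpace B n m ≃ₗ[ℝ] BigSpace B n m) ×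
      (𝓢(Fin m → Fin n → B, ℂ) ≃L[ℂ] 𝓢(Fin m → Fin n → B, ℂ)) //
    p ∈ metaplectic H m ∧
      ∃ A : Matrix (Fin m ⊕ Fin m) (Fin m ⊕ Fin m) B, IsDualIsometry A ∧
        ∀ w, p.1 (rightMul w A) = w}

/-- The Weil representation `ω` of `G̃'` on `𝓢(V^m)`. -/
def weil (H : Matrix (Fin n) (Fin n) B) (g' : DualCover H m) :
    𝓢(Fin m → Fin n → B, ℂ) ≃L[ℂ] 𝓢(Fin m → Fin n → B, ℂ) := g'.1.2

/-- The topology of `G̃'`: the coarsest one for which `γ` depends continuously on `(γ, T)` and all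
`L²` matrix coefficients of `T` are continuous (on unitary operators the weak operator topology is
the strong one). -/
noncomputable instance (H : Matrix (Fin n) (Fin n) B) : TopologicalSpace (DualCover H m) :=
  TopologicalSpace.induced
    (fun g' => ((fun w => g'.1.1 w, fun f => l2Inner f.1 (weil H g' f.2)) :
      (BigSpace B n m → BigSpace B n m) ×
      (𝓢(Fin m → Fin n → B, ℂ) × 𝓢(Fin m → Fin n → B, ℂ) → ℂ))) inferInstance

/-! ## Schwartz function valued forms -/

/-- `(L_{g⁻¹})_* : T_z D → T_{z₀} D`, which is `X ↦ g⁻¹ X g`, for `g ∈ G` with `g z₀ = z`. -/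
noncomputable def pullTangent {H z₀ z : Matrix (Fin n) (Fin n) B}
    (g : (Matrix (Fin n) (Fin n) B)ˣ) (hgG : g ∈ isometryGroup H) (hg : act g z₀ = z) :
    tangent H z →ₗ[ℝ] tangent H z₀ where
  toFun X := ⟨(g⁻¹ : (Matrix (Fin n) (Fin n) B)ˣ) * X.1 * g, by
    obtain ⟨X, hX, hX'⟩ := X
    have h0 : (g : Matrix (Fin n) (Fin n) B)ᴴ * H * (g : Matrix (Fin n) (Fin n) B) = H := hgG
    have h1 : H * ((g⁻¹ : (Matrix (Fin n) (Fin n) B)ˣ) : Matrix (Fin n) (Fin n) B) =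
        (g : Matrix (Fin n) (Fin n) B)ᴴ * H := by
      conv_lhs => rw [← h0]
      rw [mul_assoc, Units.mul_inv, mul_one]
    have h2 : ((g⁻¹ : (Matrix (Fin n) (Fin n) B)ˣ) : Matrix (Fin n) (Fin n) B)ᴴ * H =
        H * (g : Matrix (Fin n) (Fin n) B) := by
      conv_lhs => rw [← h0]
      rw [← mul_assoc, ← mul_assoc, ← Matrix.conjTranspose_mul, Units.mul_inv,
        Matrix.conjTranspose_one, one_mul]
    have h3 : z * (g : Matrix (Fin n) (Fin n) B) = g * z₀ := by
      rw [← hg, act, mul_assoc, Units.inv_mul, mul_one]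
    have h4 : ((g⁻¹ : (Matrix (Fin n) (Fin n) B)ˣ) : Matrix (Fin n) (Fin n) B) * z =
        z₀ * (g⁻¹ : (Matrix (Fin n) (Fin n) B)ˣ) := by
      rw [← hg, act, ← mul_assoc, ← mul_assoc, Units.inv_mul, one_mul]
    refine ⟨?_, ?_⟩
    · calc _ = (g : Matrix (Fin n) (Fin n) B)ᴴ * (Xᴴ *
            (((g⁻¹ : (Matrix (Fin n) (Fin n) B)ˣ) : Matrix (Fin n) (Fin n) B)ᴴ * H)) +
            (H * ((g⁻¹ : (Matrix (Fin n) (Fin n) B)ˣ) : Matrix (Fin n) (Fin n) B)) * X * g := by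
            simp only [Matrix.conjTranspose_mul, mul_assoc]
        _ = (g : Matrix (Fin n) (Fin n) B)ᴴ * (Xᴴ * H + H * X) * g := by
            rw [h1, h2]; simp only [mul_add, add_mul, mul_assoc]
        _ = 0 := by rw [hX, mul_zero, zero_mul]
    · calc _ = (g⁻¹ : (Matrix (Fin n) (Fin n) B)ˣ) * X * (g * z₀) := by simp only [mul_assoc]
        _ = (g⁻¹ : (Matrix (Fin n) (Fin n) B)ˣ) * (X * z) * g := by
            rw [← h3]; simp only [mul_assoc]
        _ = -(((g⁻¹ : (Matrix (Fin n) (Fin n) B)ˣ) * z) * X * g) := by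
            rw [hX']; simp only [mul_neg, neg_mul, mul_assoc]
        _ = _ := by rw [h4]; simp only [mul_assoc]⟩
  map_add' X Y := by ext1; simp [mul_add, add_mul]
  map_smul' r X := by ext1; simp

/-- `⋀^• 𝔭* ⊗ 𝓢(V^m)`, for `𝔭 = 𝔭_{z₀}`: an element is given by its components of every degree
`d`, alternating real multilinear maps on `𝔭₀` with values in `𝓢(V^m)` (they vanish for
`d > dim 𝔭₀`). -/
abbrev SchwartzForm (H z₀ : Matrix (Fin n) (Fin n) B) (m : ℕ) : Type :=
  ∀ d : ℕ, (tangent H z₀) [⋀^Fin d]→ₗ[ℝ] 𝓢(Fin m → Fin n → B, ℂ)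

/-- `⋀^• T_z^* D ⊗ ℂ`. -/
abbrev FormAt (H z : Matrix (Fin n) (Fin n) B) : Type :=
  ∀ d : ℕ, (tangent H z) [⋀^Fin d]→ₗ[ℝ] ℂ

/-- Evaluation of Schwartz functions at a point. -/
noncomputable def evalAt {E : Type} [NormedAddCommGroup E] [NormedSpace ℝ E] (x : E) : 𝓢(E, ℂ) →ₗ[ℝ] ℂ where
  toFun f := f x
  map_add' _ _ := rfl
  map_smul' _ _ := rfl

/-- Invariance of `ψ` under the stabiliser `K` of `z₀`: `ψ(X₁, …, X_d)(x)` equals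
`ψ(Ad(k⁻¹) X₁, …, Ad(k⁻¹) X_d)(k⁻¹ x)` for `k ∈ K`. -/
def IsKInvariant {H z₀ : Matrix (Fin n) (Fin n) B} (ψ : SchwartzForm H z₀ m) : Prop :=
  ∀ (k : (Matrix (Fin n) (Fin n) B)ˣ) (hkG : k ∈ isometryGroup H) (hk : act k z₀ = z₀) (d : ℕ)
    (X : Fin d → tangent H z₀) (x : Fin m → Fin n → B),
    ψ d X x = ψ d (fun i => pullTangent k hkG hk (X i)) (actTuple k⁻¹ x)

/-- The translated form `ψ̃(z, g', x) = L_{g⁻¹}^* (ω(g, g') ψ(x))`, computed with an element `g`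
of `G` such that `g z₀ = z`; here `ω(g, g') ψ(x) = (ω(g') ψ)(g⁻¹ x)`. -/
noncomputable def translatedForm {H z₀ z : Matrix (Fin n) (Fin n) B} (ψ : SchwartzForm H z₀ m)
    (g : (Matrix (Fin n) (Fin n) B)ˣ) (hgG : g ∈ isometryGroup H) (hg : act g z₀ = z)
    (g' : DualCover H m) (x : Fin m → Fin n → B) : FormAt H z :=
  fun d => ((evalAt (actTuple g⁻¹ x)).comp
      ((weil H g').toLinearEquiv.toLinearMap.restrictScalars ℝ)).compAlternatingMap
    ((ψ d).compLinearMap (pullTangent g hgG hg))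

/-- `e` is an orthonormal basis of `T_z D` for the Riemannian metric. -/
def IsOrthonormalBasis {H z : Matrix (Fin n) (Fin n) B} {N : ℕ} (e : Fin N → tangent H z) : Prop :=
  (∀ i j, traceForm (e i).1 (e j).1 = if i = j then 1 else 0) ∧
    Submodule.span ℝ (Set.range e) = ⊤

/-- The norm of `ω ∈ ⋀^• T_z^* D ⊗ ℂ` induced by the Riemannian metric, computed in an orthonormal
basis `e` of `T_z D` (of which it does not depend): the components of `ω` with respect to the
orthonormal basis `e_s^*`, `s ⊆ {1, …, N}`, of `⋀^• T_z^* D` are the values of `ω` at the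
increasing families `e_s`. -/
noncomputable def formNorm {H z : Matrix (Fin n) (Fin n) B} {N : ℕ} (e : Fin N → tangent H z)
    (ω : FormAt H z) : ℝ :=
  Real.sqrt (∑ s : Finset (Fin N), ‖ω s.card (fun i => e (s.orderEmbOfFin rfl i))‖ ^ 2)

/-- The value `∑_l ‖g⁻¹ x_l‖²_{z₀}` of `M_{z₀}(z, x)` at `z = g z₀`. -/
noncomputable def majorantSum (H z₀ : Matrix (Fin n) (Fin n) B)
    (g : (Matrix (Fin n) (Fin n) B)ˣ) (x : Fin m → Fin n → B) : ℝ :=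
  ∑ l, majorant H z₀ (actTuple g⁻¹ x l)

end CycleDecay

open CycleDecay

/-!
Write `h_I(v) = Re (v, I v)` for the majorant of a point `I` of `D`, and
`M(I, x) = ∑ h_I(x_l)`. Since `h_{z₀}(g⁻¹ v) = h_{g z₀}(v)`, the sum `M_{z₀}(z, x)` is `M(z, x)`
whatever the base point `z₀` is (`majorantSum_eq`).

*Growth.* Let `Z` be the operator `z'` extended by zero to `U^⊥`, and `p` the orthogonal projection
on `U`. As the `x_l` span `U`, there is a constant `C` with `h_I ≤ κ h_Z` on `U` for
`κ = C M(I, x)` (`exists_majorant_le`), and `κ ≥ 1` if `U ≠ 0`. It remains to find a point `J` of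
`D_{U,z'}` at distance `O(log κ)` from `I`. Let `q = 1 - p`. The operator `N = Z + q I q` is skew
for the form, `H N` is positive definite, and the unitary part `J = N (-N²)^{-1/2}` of `N` in its
polar decomposition belongs to `D_{U,z'}`. The norm of `q` for `h_I` is at most `1 + κ`, because
`p y` can be recovered from the pairing of `y` with `Z p y`; so `-N²` has eigenvalues in
`(0, (1 + κ)²]`, and `h_I ≤ 4 κ² h_J` follows (`IsPartialStructure.exists_point`). Finally
`t ↦ J S ^ t`, with `S = J⁻¹ I`, is a curve in `D` from `J` to `I` of constant speed, and the
eigenvalues of `S` lie in `[1/K, K]` for `K = 4 κ²`, so that its length is at most `(√n / 2) log K`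
(`riemDist_le_log`). Together, `d(D_{U,z'}, I) ≤ √n log (2 C M(I, x))`, which is the asserted
growth (`exists_exp_riemDist_le`).

*Decay.* Since `ω(g')` is unitary and conjugates `ρ(w)` to `ρ(γ w)`, with `γ` depending
continuously on `g'`, the `L²` norm of `ρ(w₁) ⋯ ρ(w_k) ω(g') f` is bounded by a continuous function
of `g'` (`exists_continuous_l2NormSq_le`). A Sobolev inequality
(`exists_norm_le_l2NormSq_lineDeriv`) turns this into pointwise bounds, and the multiplication
operators among the `ρ(w)` into bounds for `(∑ h_{z₀}(y_l)) ^ k |ω(g') f (y)|`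
(`exists_continuous_majorant_pow_mul_le`). At `y = g⁻¹ x`, where `g z₀ = z`, the first factor is
`M(z, x) ^ k`, which by the growth estimate outweighs `exp (ρ d(D_{U,z'}, z))` for large `k`. The
values of `ψ` on an orthonormal basis are controlled by finitely many Schwartz functions, since `g`
acts by isometries on tangent spaces (`exists_continuous_formNorm_le`). If `U = 0`, then
`D_{U,z'} = D` and the distance is zero.
-/

set_option linter.unusedSectionVars false

namespace CycleDecay

/-! ### A Sobolev inequality for Schwartz functions -/

section Sobolev

open MeasureTheory FourierTransform LineDeriv SchwartzMap

/-- The trivial bound in Fourier inversion. -/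
theorem norm_le_integral_norm_fourier {N : ℕ} (F : 𝓢(EuclideanSpace ℝ (Fin N), ℂ))
    (y : EuclideanSpace ℝ (Fin N)) : ‖F y‖ ≤ ∫ ξ, ‖𝓕 F ξ‖ := by
  have h1 : 𝓕⁻ (𝓕 F) = F := fourierInv_fourier_eq F
  have h2 : F y = 𝓕 (⇑(𝓕 F : 𝓢(EuclideanSpace ℝ (Fin N), ℂ))) (-y) := by
    conv_lhs => rw [← h1]
    rw [fourierInv_coe, Real.fourierInv_eq_fourier_neg]
  rw [h2]
  exact VectorFourier.norm_fourierIntegral_le_integral_norm _ _ _ _ _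

theorem fourier_lineDerivOp_iterate {V : Type*} [NormedAddCommGroup V] [InnerProductSpace ℝ V]
    [FiniteDimensional ℝ V] [MeasurableSpace V] [BorelSpace V] (F : 𝓢(V, ℂ)) (v : V) (K : ℕ)
    (ξ : V) :
    𝓕 ((fun f : 𝓢(V, ℂ) => ∂_{v} f)^[K] F) ξ =
      (2 * Real.pi * Complex.I * (inner ℝ ξ v : ℝ)) ^ K * 𝓕 F ξ := by
  induction K generalizing ξ with
  | zero => simp
  | succ K ih =>
    have : (inner ℝ · v : V → ℝ).HasTemperateGrowth := by fun_prop
    rw [Function.iterate_succ_apply', fourier_lineDerivOp_eq, smul_apply,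
      smulLeftCLM_apply_apply this, ih, Complex.real_smul, smul_eq_mul, pow_succ]
    ring

/-- Convexity of `t ↦ t ^ (K + 1)` bounds the Bessel weight by pure powers of the coordinates. -/
theorem one_add_norm_sq_pow_le {N : ℕ} (K : ℕ) (ξ : EuclideanSpace ℝ (Fin N)) :
    (1 + ‖ξ‖ ^ 2) ^ (K + 1) ≤
      (N + 1 : ℝ) ^ K * (1 + ∑ j, (ξ j ^ 2) ^ (K + 1)) := by
  have h := pow_sum_div_card_le_sum_pow (s := (Finset.univ : Finset (Option (Fin N))))
    (f := fun o => o.elim (1 : ℝ) fun j => ξ j ^ 2) (by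
      intro o _; cases o <;> simp; positivity) K
  simp only [Fintype.sum_option, Option.elim, Finset.card_univ, Fintype.card_option,
    Fintype.card_fin, one_pow] at h
  rw [div_le_iff₀ (by positivity)] at h
  rw [EuclideanSpace.norm_sq_eq]
  simp only [Real.norm_eq_abs, sq_abs]
  push_cast at h
  linarith

/-- A Sobolev inequality in an inhomogeneous form that needs no Cauchy–Schwarz inequality: the
Fourier transform is integrated against a square integrable weight and its inverse. -/
theorem exists_norm_le_integral_sq_euclidean (N : ℕ) : ∃ (K : ℕ) (C : ℝ), 0 < C ∧
    ∀ (F : 𝓢(EuclideanSpace ℝ (Fin N), ℂ)) y, ‖F y‖ ≤ C * (1 + (∫ x, ‖F x‖ ^ 2) +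
      ∑ j : Fin N, ∫ x, ‖((fun f : 𝓢(EuclideanSpace ℝ (Fin N), ℂ) =>
        ∂_{EuclideanSpace.single j (1 : ℝ)} f)^[K] F) x‖ ^ 2) := by
  set W : EuclideanSpace ℝ (Fin N) → ℝ := fun ξ => (1 + ‖ξ‖ ^ 2) ^ (-((2 * (N + 1) : ℕ) : ℝ) / 2)
    with hW
  have hWint : Integrable W := by
    apply integrable_rpow_neg_one_add_norm_sq
    simp only [finrank_euclideanSpace, Fintype.card_fin]
    push_cast; linarith
  have hWeq : ∀ ξ, W ξ = ((1 + ‖ξ‖ ^ 2) ^ (N + 1))⁻¹ := by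
    intro ξ
    simp only [hW]
    rw [show (-((2 * (N + 1) : ℕ) : ℝ) / 2) = -((N + 1 : ℕ) : ℝ) by push_cast; ring,
      Real.rpow_neg (by positivity), Real.rpow_natCast]
  have hWnn : 0 ≤ ∫ ξ, W ξ := integral_nonneg fun ξ => by rw [hWeq]; positivity
  set A : ℝ := (N + 1 : ℝ) ^ N with hA
  have hA0 : 0 < A := by positivity
  refine ⟨N + 1, A + ∫ ξ, W ξ, by positivity, fun F y => ?_⟩
  have hsq : ∀ G : 𝓢(EuclideanSpace ℝ (Fin N), ℂ), Integrable (fun x => ‖G x‖ ^ 2) := fun G => by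
    have := (G.memLp 2 volume).integrable_norm_pow (by norm_num)
    simpa using this
  set D : Fin N → 𝓢(EuclideanSpace ℝ (Fin N), ℂ) := fun j =>
    ((fun f : 𝓢(EuclideanSpace ℝ (Fin N), ℂ) =>
        ∂_{EuclideanSpace.single j (1 : ℝ)} f)^[N + 1] F) with hD
  -- differentiation in direction `j` multiplies the Fourier transform by `2 π i ξ j`
  have hDF : ∀ j ξ, (ξ j ^ 2) ^ (N + 1) * ‖𝓕 F ξ‖ ^ 2 ≤ ‖𝓕 (D j) ξ‖ ^ 2 := by
    intro j ξ
    rw [hD, fourier_lineDerivOp_iterate, norm_mul, mul_pow, norm_pow]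
    gcongr
    refine le_of_le_of_eq ?_ (pow_right_comm _ 2 (N + 1))
    refine pow_le_pow_left₀ (sq_nonneg _) ?_ _
    have h1 : (1 : ℝ) ≤ 2 ^ 2 * Real.pi ^ 2 := by nlinarith [Real.pi_gt_three]
    have h2 : ‖(2 * Real.pi * Complex.I * (inner ℝ ξ (EuclideanSpace.single j (1 : ℝ)) : ℝ) : ℂ)‖ ^ 2
        = 2 ^ 2 * Real.pi ^ 2 * ξ j ^ 2 := by
      simp [EuclideanSpace.inner_single_right, mul_pow]
    rw [h2]
    nlinarith [sq_nonneg (ξ j)]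
  have hpt : ∀ ξ, ‖𝓕 F ξ‖ ≤ W ξ + A * (‖𝓕 F ξ‖ ^ 2 + ∑ j, ‖𝓕 (D j) ξ‖ ^ 2) := by
    intro ξ
    have h1 : (1 + ‖ξ‖ ^ 2) ^ (N + 1) * ‖𝓕 F ξ‖ ^ 2 ≤
        A * (‖𝓕 F ξ‖ ^ 2 + ∑ j, ‖𝓕 (D j) ξ‖ ^ 2) := by
      calc _ ≤ A * (1 + ∑ j, (ξ j ^ 2) ^ (N + 1)) * ‖𝓕 F ξ‖ ^ 2 := by
            gcongr; exact one_add_norm_sq_pow_le N ξ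
        _ = A * (‖𝓕 F ξ‖ ^ 2 + ∑ j, (ξ j ^ 2) ^ (N + 1) * ‖𝓕 F ξ‖ ^ 2) := by
            rw [← Finset.sum_mul]; ring
        _ ≤ _ := by gcongr; exact hDF _ ξ
    set w := (1 + ‖ξ‖ ^ 2) ^ (N + 1)
    have hw : 0 < w := by positivity
    rw [hWeq]
    refine le_trans ?_ (add_le_add_right h1 _)
    set t := ‖𝓕 F ξ‖
    -- `t ≤ w⁻¹ + w t²`, by the inequality of the two means
    have h3 : w⁻¹ * (w * t) = t := by field_simp
    have h4 : w⁻¹ + w * t ^ 2 - t = w⁻¹ * ((1 - w * t) ^ 2 + w * t) := by field_simp; ring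
    have h5 : 0 ≤ w⁻¹ * ((1 - w * t) ^ 2 + w * t) := by
      have : 0 ≤ t := norm_nonneg _
      positivity
    linarith
  have hint : Integrable fun ξ => A * (‖𝓕 F ξ‖ ^ 2 + ∑ j, ‖𝓕 (D j) ξ‖ ^ 2) :=
    ((hsq _).add (integrable_finsetSum _ fun j _ => hsq _)).const_mul A
  calc ‖F y‖ ≤ ∫ ξ, ‖𝓕 F ξ‖ := norm_le_integral_norm_fourier F y
    _ ≤ ∫ ξ, (W ξ + A * (‖𝓕 F ξ‖ ^ 2 + ∑ j, ‖𝓕 (D j) ξ‖ ^ 2)) :=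
        integral_mono (𝓕 F).integrable.norm (hWint.add hint) hpt
    _ = (∫ ξ, W ξ) + A * ((∫ x, ‖F x‖ ^ 2) + ∑ j, ∫ x, ‖D j x‖ ^ 2) := by
        rw [integral_add hWint hint, integral_const_mul, integral_add (hsq _)
          (integrable_finsetSum _ fun j _ => hsq _), integral_finsetSum _ fun j _ => hsq _,
          integral_norm_sq_fourier]
        simp only [integral_norm_sq_fourier]
    _ ≤ _ := by
        have h1 : 0 ≤ ∫ x, ‖F x‖ ^ 2 := integral_nonneg fun _ => by positivity
        have h2 : 0 ≤ ∑ j, ∫ x, ‖D j x‖ ^ 2 :=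
          Finset.sum_nonneg fun j _ => integral_nonneg fun _ => by positivity
        nlinarith [mul_nonneg hWnn h1, mul_nonneg hWnn h2]

variable {E : Type} [NormedAddCommGroup E] [NormedSpace ℝ E] [FiniteDimensional ℝ E]

/-- The squared `L²` norm belonging to `l2Inner`. -/
noncomputable def l2NormSq (F : 𝓢(E, ℂ)) : ℝ := (l2Inner F F).re

theorem l2NormSq_eq_integral (F : 𝓢(E, ℂ)) :
    letI : MeasurableSpace E := borel E
    haveI : BorelSpace E := ⟨rfl⟩
    haveI : ProperSpace E := FiniteDimensional.proper_real E
    l2NormSq F = ∫ x, ‖F x‖ ^ 2 ∂(Measure.addHaar : Measure E) := by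
  let _ : MeasurableSpace E := borel E
  have : BorelSpace E := ⟨rfl⟩
  have : ProperSpace E := FiniteDimensional.proper_real E
  have h : l2Inner F F = ((∫ x, ‖F x‖ ^ 2 ∂(Measure.addHaar : Measure E) : ℝ) : ℂ) := by
    rw [← integral_complex_ofReal]
    refine integral_congr_ae (Filter.Eventually.of_forall fun x => ?_)
    simp only [Complex.ofReal_pow]
    exact Complex.conj_mul' (F x)
  change (l2Inner F F).re = _
  rw [h, Complex.ofReal_re]

theorem l2NormSq_nonneg (F : 𝓢(E, ℂ)) : 0 ≤ l2NormSq F := by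
  rw [l2NormSq_eq_integral]
  exact integral_nonneg fun x => by positivity

theorem l2NormSq_smul (c : ℝ) (F : 𝓢(E, ℂ)) : l2NormSq (c • F) = c ^ 2 * l2NormSq F := by
  rw [l2NormSq_eq_integral, l2NormSq_eq_integral, ← integral_const_mul]
  refine integral_congr_ae (Filter.Eventually.of_forall fun x => ?_)
  simp only [smul_apply, norm_smul, mul_pow, Real.norm_eq_abs, sq_abs]

theorem l2NormSq_sum_le {ι : Type*} (s : Finset ι) (F : ι → 𝓢(E, ℂ)) :
    l2NormSq (∑ i ∈ s, F i) ≤ s.card * ∑ i ∈ s, l2NormSq (F i) := by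
  simp only [l2NormSq_eq_integral]
  let _ : MeasurableSpace E := borel E
  have : BorelSpace E := ⟨rfl⟩
  have : ProperSpace E := FiniteDimensional.proper_real E
  have hsq : ∀ G : 𝓢(E, ℂ), Integrable (fun x => ‖G x‖ ^ 2) (Measure.addHaar : Measure E) :=
    fun G => by
      have := (G.memLp 2 (Measure.addHaar : Measure E)).integrable_norm_pow (by norm_num)
      simpa using this
  rw [← integral_finsetSum _ fun i _ => hsq _, ← integral_const_mul]
  refine integral_mono (hsq _) ((integrable_finsetSum _ fun i _ => hsq _).const_mul _) fun x => ?_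
  simp only [sum_apply]
  calc ‖∑ i ∈ s, F i x‖ ^ 2 ≤ (∑ i ∈ s, ‖F i x‖) ^ 2 := by gcongr; exact norm_sum_le _ _
    _ ≤ _ := sq_sum_le_card_mul_sum_sq

theorem lineDerivOp_iterate_compCLM {D E : Type*} [NormedAddCommGroup E] [NormedSpace ℝ E]
    [NormedAddCommGroup D] [NormedSpace ℝ D]
    (g : D ≃L[ℝ] E) (F : 𝓢(E, ℂ)) (v : D) (K : ℕ) :
    (fun f : 𝓢(D, ℂ) => ∂_{v} f)^[K] (compCLMOfContinuousLinearEquiv ℂ g F) =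
      compCLMOfContinuousLinearEquiv ℂ g ((fun f : 𝓢(E, ℂ) => ∂_{g v} f)^[K] F) := by
  induction K with
  | zero => rfl
  | succ K ih =>
    rw [Function.iterate_succ_apply', Function.iterate_succ_apply', ih,
      lineDerivOp_compCLMOfContinuousLinearEquiv]

/-- A Sobolev inequality for Schwartz functions on a finite dimensional space, in the
inhomogeneous form that suffices for locally uniform bounds: pointwise values are bounded by the
`L²` norms of the function and of its pure derivatives of one high order. -/
theorem exists_norm_le_l2NormSq_lineDeriv (E : Type) [NormedAddCommGroup E] [NormedSpace ℝ E]
    [FiniteDimensional ℝ E] : ∃ (N : ℕ) (v : Fin N → E) (K : ℕ) (C : ℝ), 0 < C ∧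
    ∀ (F : 𝓢(E, ℂ)) (y : E), ‖F y‖ ≤ C * (1 + l2NormSq F +
      ∑ j, l2NormSq ((fun f : 𝓢(E, ℂ) => ∂_{v j} f)^[K] F)) := by
  let _ : MeasurableSpace E := borel E
  have : BorelSpace E := ⟨rfl⟩
  have : ProperSpace E := FiniteDimensional.proper_real E
  set N := Module.finrank ℝ E
  let e : EuclideanSpace ℝ (Fin N) ≃L[ℝ] E := toEuclidean.symm
  obtain ⟨K, C, hC, h⟩ := exists_norm_le_integral_sq_euclidean N
  -- linear coordinates carry Lebesgue measure to a multiple `c` of the Haar measure of `E`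
  let μ : Measure E := Measure.map e volume
  have : μ.IsAddHaarMeasure := e.isAddHaarMeasure_map volume
  let c : ℝ := (Measure.addHaarScalarFactor μ (Measure.addHaar : Measure E) : ℝ)
  have hc0 : 0 ≤ c := NNReal.coe_nonneg _
  have hμ : μ = Measure.addHaarScalarFactor μ (Measure.addHaar : Measure E) •
      (Measure.addHaar : Measure E) := Measure.isAddLeftInvariant_eq_smul _ _
  have hint : ∀ G : 𝓢(E, ℂ), ∫ x, ‖compCLMOfContinuousLinearEquiv ℂ e G x‖ ^ 2 =
      c * l2NormSq G := by
    intro G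
    have h1 : ∫ x, ‖compCLMOfContinuousLinearEquiv ℂ e G x‖ ^ 2 = ∫ x, ‖G x‖ ^ 2 ∂μ :=
      (e.toHomeomorph.measurableEmbedding.integral_map (fun x => ‖G x‖ ^ 2)).symm
    rw [h1, hμ, integral_smul_nnreal_measure, l2NormSq_eq_integral]
    rfl
  refine ⟨N, fun j => e (EuclideanSpace.single j 1), K, C * (1 + c), by positivity,
    fun F y => ?_⟩
  have h1 := h (compCLMOfContinuousLinearEquiv ℂ e F) (e.symm y)
  simp only [lineDerivOp_iterate_compCLM, hint] at h1
  have h2 : compCLMOfContinuousLinearEquiv ℂ e F (e.symm y) = F y := by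
    simp [compCLMOfContinuousLinearEquiv_apply]
  rw [h2] at h1
  refine h1.trans ?_
  rw [mul_assoc]
  gcongr
  rw [← Finset.mul_sum]
  have h3 := l2NormSq_nonneg F
  have h4 : 0 ≤ ∑ j, l2NormSq ((fun f : 𝓢(E, ℂ) => ∂_{e (EuclideanSpace.single j 1)} f)^[K] F) :=
    Finset.sum_nonneg fun j _ => l2NormSq_nonneg _
  nlinarith

end Sobolev

/-! ### The three base algebras -/

section Base

variable {B : Type} [NormedDivisionRing B] [NormedAlgebra ℝ B] [StarRing B] [StarModule ℝ B]
  [FiniteDimensional ℝ B] [RealPart B]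

omit [StarModule ℝ B] [FiniteDimensional ℝ B] in
theorem re_mul_comm (hB : IsBase B) (a b : B) : RealPart.re (a * b) = RealPart.re (b * a) := by
  cases hB with
  | caseA => rw [mul_comm]
  | caseB => rw [mul_comm]
  | caseC =>
    change (a * b).re = (b * a).re
    simp only [Quaternion.re_mul]; ring

theorem re_star (hB : IsBase B) (a : B) : RealPart.re (star a) = RealPart.re a := by
  cases hB with
  | caseA => exact Complex.conj_re a
  | caseB => rfl
  | caseC => exact Quaternion.re_star a

theorem re_one (hB : IsBase B) : RealPart.re (1 : B) = 1 := by
  cases hB <;> rfl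

theorem re_star_mul_self (hB : IsBase B) (b : B) : RealPart.re (star b * b) = ‖b‖ ^ 2 := by
  cases hB with
  | caseA =>
    change ((starRingEnd ℂ) b * b).re = _
    rw [← Complex.normSq_eq_conj_mul_self, Complex.ofReal_re, Complex.normSq_eq_norm_sq]
  | caseB =>
    change b * b = _
    rw [Real.norm_eq_abs, sq_abs, sq]
  | caseC =>
    change (star b * b).re = _
    rw [Quaternion.star_mul_self, Quaternion.re_coe, Quaternion.normSq_eq_norm_mul_self, sq]

theorem re_star_mul_self_pos (hB : IsBase B) {a : B} (ha : a ≠ 0) :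
    0 < RealPart.re (star a * a) := by
  rw [re_star_mul_self hB]
  exact pow_pos (norm_pos_iff.2 ha) 2

theorem exists_algebraMap_of_star_eq_self (hB : IsBase B) {a : B} (ha : star a = a) :
    ∃ r : ℝ, a = algebraMap ℝ B r := by
  cases hB with
  | caseA => exact ⟨a.re, (Complex.conj_eq_iff_re.1 ha).symm⟩
  | caseB => exact ⟨a, rfl⟩
  | caseC => exact ⟨a.re, (Quaternion.star_eq_self.1 ha)⟩

/-- The trace of left multiplication by `b`, as a real linear map, is a multiple of the real part
of `b`. -/
theorem trace_mulLeft (hB : IsBase B) (b : B) :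
    LinearMap.trace ℝ B (LinearMap.mulLeft ℝ b) = Module.finrank ℝ B * RealPart.re b := by
  cases hB with
  | caseA =>
    have h := Algebra.trace_complex_apply b
    rw [Algebra.trace_apply] at h
    rw [Complex.finrank_real_complex]
    exact_mod_cast h
  | caseB =>
    have h := Algebra.trace_self_apply (R := ℝ) b
    rw [Algebra.trace_apply] at h
    rw [Module.finrank_self, Nat.cast_one, one_mul]
    exact h
  | caseC =>
    let bs : Module.Basis (Fin 4) ℝ ℍ[ℝ] := QuaternionAlgebra.basisOneIJK (-1 : ℝ) 0 (-1)
    have hr : ∀ q : ℍ[ℝ], ⇑(bs.repr q) = ![q.re, q.imI, q.imJ, q.imK] := fun _ => rfl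
    have hb : ∀ i, bs i = (QuaternionAlgebra.equivTuple (-1 : ℝ) 0 (-1)).symm (Pi.single i 1) :=
      fun i => congrFun (Module.Basis.coe_ofEquivFun
        (QuaternionAlgebra.linearEquivTuple (-1 : ℝ) 0 (-1))) i
    rw [Quaternion.finrank_eq_four, LinearMap.trace_eq_matrix_trace ℝ bs]
    simp only [Matrix.trace, Matrix.diag, LinearMap.toMatrix_apply]
    change ∑ i, bs.repr (b * bs i) i = _
    simp only [Fin.sum_univ_four, hr, hb]
    have h0 : Pi.single (0 : Fin 4) (1 : ℝ) = ![1, 0, 0, 0] := by ext i; fin_cases i <;> rfl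
    have h1 : Pi.single (1 : Fin 4) (1 : ℝ) = ![0, 1, 0, 0] := by ext i; fin_cases i <;> rfl
    have h2 : Pi.single (2 : Fin 4) (1 : ℝ) = ![0, 0, 1, 0] := by ext i; fin_cases i <;> rfl
    have h3 : Pi.single (3 : Fin 4) (1 : ℝ) = ![0, 0, 0, 1] := by ext i; fin_cases i <;> rfl
    rw [h0, h1, h2, h3]
    -- the components of `b` times the units `1, i, j, k`
    let q0 : ℍ[ℝ] := ⟨1, 0, 0, 0⟩
    let q1 : ℍ[ℝ] := ⟨0, 1, 0, 0⟩
    let q2 : ℍ[ℝ] := ⟨0, 0, 1, 0⟩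
    let q3 : ℍ[ℝ] := ⟨0, 0, 0, 1⟩
    change (b * q0).re + (b * q1).imI + (b * q2).imJ + (b * q3).imK = ((4 : ℕ) : ℝ) * b.re
    rw [Quaternion.re_mul, Quaternion.imI_mul, Quaternion.imJ_mul, Quaternion.imK_mul]
    simp only [q0, q1, q2, q3]
    push_cast
    ring

end Base

/-! ### Positive definite real forms -/

section PositiveDefinite

variable {V : Type*} [AddCommGroup V] [Module ℝ V]

/-- A positive definite symmetric bilinear form on a real vector space, viewed as an inner
product. -/
abbrev innerCore (b : LinearMap.BilinForm ℝ V) (hs : ∀ v w, b v w = b w v)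
    (hp : ∀ v, v ≠ 0 → 0 < b v v) : InnerProductSpace.Core ℝ V where
  inner v w := b v w
  conj_inner_symm v w := hs w v
  re_inner_nonneg v := by
    by_cases h : v = 0
    · simp [h]
    · exact (hp v h).le
  add_left u v w := by simp
  smul_left u v r := by simp
  definite v h := by
    by_contra h0
    exact (hp v h0).ne' h

variable [FiniteDimensional ℝ V] (b : LinearMap.BilinForm ℝ V) (hs : ∀ v w, b v w = b w v)
  (hp : ∀ v, v ≠ 0 → 0 < b v v)

include hs hp in
/-- The spectral theorem: a symmetric operator is a root of a polynomial with simple real roots,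
all of them eigenvalues. -/
theorem exists_aeval_nodal_eq_zero (T : Module.End ℝ V) (hT : ∀ v w, b (T v) w = b v (T w)) :
    ∃ Λ : Finset ℝ, Polynomial.aeval T (Lagrange.nodal Λ id) = 0 ∧
      ∀ l ∈ Λ, ∃ v, v ≠ 0 ∧ T v = l • v := by
  let c := innerCore b hs hp
  let _ : NormedAddCommGroup V := c.toNormedAddCommGroup
  let _ : InnerProductSpace ℝ V := InnerProductSpace.ofCore c.toCore
  have hT' : T.IsSymmetric := hT
  -- the eigenspaces span, and the polynomial kills each of them
  have htop : ⨆ μ, Module.End.eigenspace T μ = ⊤ :=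
    Submodule.orthogonal_eq_bot_iff.1 hT'.orthogonalComplement_iSup_eigenspaces_eq_bot
  refine ⟨(Module.End.finite_hasEigenvalue T).toFinset, ?_, ?_⟩
  · have hle : (⊤ : Submodule ℝ V) ≤ LinearMap.ker (Polynomial.aeval T
        (Lagrange.nodal (Module.End.finite_hasEigenvalue T).toFinset id)) := by
      rw [← htop]
      refine iSup_le fun μ v hv => ?_
      rw [LinearMap.mem_ker]
      by_cases h0 : v = 0
      · rw [h0, map_zero]
      have hμ : T.HasEigenvalue μ := Module.End.hasEigenvalue_of_hasEigenvector ⟨hv, h0⟩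
      rw [Module.End.aeval_apply_of_hasEigenvector ⟨hv, h0⟩,
        Lagrange.eval_nodal, Finset.prod_eq_zero (i := μ) (by simpa using hμ) (by simp), zero_smul]
    ext v
    exact hle (Submodule.mem_top (x := v))
  · intro l hl
    obtain ⟨v, hv⟩ := Module.End.HasEigenvalue.exists_hasEigenvector
      ((Module.End.finite_hasEigenvalue T).mem_toFinset.1 hl)
    exact ⟨v, hv.2, hv.apply_eq_smul⟩

include hs hp in
/-- In an orthonormal basis, the trace of `T²` is the sum of the squared norms of the columns of
`T`. -/
theorem trace_mul_self_of_symmetric (T : Module.End ℝ V) (hT : ∀ v w, b (T v) w = b v (T w)) :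
    0 ≤ LinearMap.trace ℝ V (T * T) ∧ (LinearMap.trace ℝ V (T * T) = 0 → T = 0) := by
  let c := innerCore b hs hp
  let _ : NormedAddCommGroup V := c.toNormedAddCommGroup
  let _ : InnerProductSpace ℝ V := InnerProductSpace.ofCore c.toCore
  have hT' : T.IsSymmetric := hT
  let e := stdOrthonormalBasis ℝ V
  have h : LinearMap.trace ℝ V (T * T) = ∑ i, ‖T (e i)‖ ^ 2 := by
    rw [LinearMap.trace_eq_sum_inner _ e]
    refine Finset.sum_congr rfl fun i _ => ?_
    rw [← real_inner_self_eq_norm_sq]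
    exact (hT' (e i) (T (e i))).symm
  rw [h]
  refine ⟨by positivity, fun h0 => e.toBasis.ext fun i => ?_⟩
  have := (Finset.sum_eq_zero_iff_of_nonneg fun i _ => by positivity).1 h0 i (Finset.mem_univ i)
  simpa using this

include hs hp in
/-- Linear maps on a finite dimensional space are bounded for any positive definite form. -/
theorem exists_norm_sq_le {E : Type*} [NormedAddCommGroup E] [NormedSpace ℝ E] (T : V →ₗ[ℝ] E) :
    ∃ C : ℝ, 0 < C ∧ ∀ v, ‖T v‖ ^ 2 ≤ C * b v v := by
  let c := innerCore b hs hp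
  let _ : NormedAddCommGroup V := c.toNormedAddCommGroup
  let _ : InnerProductSpace ℝ V := InnerProductSpace.ofCore c.toCore
  let T' := LinearMap.toContinuousLinearMap T
  refine ⟨‖T'‖ ^ 2 + 1, by positivity, fun v => ?_⟩
  have h1 : ‖T v‖ ≤ ‖T'‖ * ‖v‖ := T'.le_opNorm v
  have h2 : b v v = ‖v‖ ^ 2 := real_inner_self_eq_norm_sq v
  calc ‖T v‖ ^ 2 ≤ (‖T'‖ * ‖v‖) ^ 2 := by gcongr
    _ ≤ _ := by rw [h2]; nlinarith [sq_nonneg ‖v‖]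

end PositiveDefinite

/-! ### Spectral calculus by interpolation -/

section SpectralCalculus

open Polynomial

variable {R : Type*} [Ring R] [Algebra ℝ R]

/-- `f(S)` for an element `S` that is annihilated by `∏_{l ∈ Λ} (X - l)`: the value at `S` of the
polynomial that interpolates `f` on `Λ`. Only the values of `f` on `Λ` matter. -/
noncomputable def spectralFun (Λ : Finset ℝ) (S : R) (f : ℝ → ℝ) : R :=
  aeval S (Lagrange.interpolate Λ id f)

theorem eval_interpolate_id {Λ : Finset ℝ} (f : ℝ → ℝ) {l : ℝ} (hl : l ∈ Λ) :
    eval l (Lagrange.interpolate Λ id f) = f l :=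
  Lagrange.eval_interpolate_at_node f (Set.injOn_id _) hl

variable {Λ : Finset ℝ} {S : R} (hS : aeval S (Lagrange.nodal Λ id) = 0)

include hS

theorem aeval_eq_of_eval_eq {p q : ℝ[X]} (h : ∀ l ∈ Λ, p.eval l = q.eval l) :
    aeval S p = aeval S q := by
  have hd : Lagrange.nodal Λ id ∣ p - q := by
    rw [Lagrange.nodal_eq]
    refine Finset.prod_dvd_of_coprime (fun a _ b _ hab => ?_) fun l hl => ?_
    · exact pairwise_coprime_X_sub_C (Function.injective_id) hab
    · rw [dvd_iff_isRoot]
      simp [h l hl]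
  obtain ⟨r, hr⟩ := hd
  rw [← sub_eq_zero, ← map_sub, hr, map_mul, hS, zero_mul]

theorem spectralFun_eq_aeval {f : ℝ → ℝ} {p : ℝ[X]} (h : ∀ l ∈ Λ, p.eval l = f l) :
    spectralFun Λ S f = aeval S p := by
  refine aeval_eq_of_eval_eq hS fun l hl => ?_
  rw [h l hl, eval_interpolate_id f hl]

theorem spectralFun_mul (f g : ℝ → ℝ) :
    spectralFun Λ S f * spectralFun Λ S g = spectralFun Λ S (fun l => f l * g l) := by
  refine (map_mul (aeval S) _ _).symm.trans (spectralFun_eq_aeval hS fun l hl => ?_).symm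
  rw [eval_mul, eval_interpolate_id f hl, eval_interpolate_id g hl]

theorem spectralFun_one : spectralFun Λ S (fun _ => 1) = 1 := by
  rw [spectralFun_eq_aeval hS (p := 1) (by simp), map_one]

theorem spectralFun_id : spectralFun Λ S (fun l => l) = S := by
  rw [spectralFun_eq_aeval hS (p := X) (by simp), aeval_X]

omit hS in
theorem spectralFun_congr {f g : ℝ → ℝ} (h : ∀ l ∈ Λ, f l = g l) :
    spectralFun Λ S f = spectralFun Λ S g := by
  rw [spectralFun, spectralFun, Lagrange.interpolate_eq_of_values_eq_on _ _ h]

/-- The spectral projection of `S` on the eigenvalue `l`. -/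
noncomputable def spectralProj (Λ : Finset ℝ) (S : R) (l : ℝ) : R :=
  aeval S (Lagrange.basis Λ id l)

omit hS in
theorem spectralFun_eq_sum (f : ℝ → ℝ) :
    spectralFun Λ S f = ∑ l ∈ Λ, f l • spectralProj Λ S l := by
  simp [spectralFun, spectralProj, Lagrange.interpolate_apply, ← Algebra.smul_def]

omit hS in
/-- An element that intertwines `S` and `S'` intertwines their polynomials. -/
theorem semiconj_aeval {P S' : R} (h : P * S = S' * P) (p : ℝ[X]) :
    P * aeval S p = aeval S' p * P := by
  induction p using Polynomial.induction_on' with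
  | add p q hp hq => rw [map_add, map_add, mul_add, add_mul, hp, hq]
  | monomial k a =>
    rw [aeval_monomial, aeval_monomial, ← mul_assoc, ← Algebra.commutes, mul_assoc,
      (show SemiconjBy P S S' from h).pow_right k |>.eq, mul_assoc]

theorem spectralProj_mul_self {l : ℝ} (hl : l ∈ Λ) :
    spectralProj Λ S l * spectralProj Λ S l = spectralProj Λ S l := by
  rw [spectralProj, ← map_mul]
  refine aeval_eq_of_eval_eq hS fun k hk => ?_
  rw [eval_mul]
  by_cases h : l = k
  · subst h
    have := Lagrange.eval_basis_self (v := (id : ℝ → ℝ)) (Set.injOn_id _) hl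
    rw [id] at this
    rw [this, one_mul]
  · have := Lagrange.eval_basis_of_ne (s := Λ) (v := (id : ℝ → ℝ)) h hk
    rw [id] at this
    rw [this, zero_mul]

/-- If conjugation by `J` inverts `S`, it turns `f(S)` into `(f ∘ inv)(S)`. -/
theorem mul_spectralFun_of_inv {J : R}
    (hJ : J * S = spectralFun Λ S (fun l => l⁻¹) * J) (f : ℝ → ℝ) :
    J * spectralFun Λ S f = spectralFun Λ S (fun l => f l⁻¹) * J := by
  classical
  -- one polynomial that interpolates `f` on `Λ` as well as on `Λ⁻¹`
  set M := Λ ∪ Λ.image (fun l => l⁻¹)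
  have hM : ∀ l ∈ M, eval l (Lagrange.interpolate M id f) = f l := fun l hl =>
    eval_interpolate_id f hl
  have h1 : spectralFun Λ S f = aeval S (Lagrange.interpolate M id f) :=
    spectralFun_eq_aeval hS fun l hl => hM l (Finset.mem_union_left _ hl)
  rw [h1, semiconj_aeval hJ, spectralFun, ← aeval_comp]
  congr 1
  refine (spectralFun_eq_aeval hS fun l hl => ?_).symm
  rw [eval_comp, eval_interpolate_id _ hl]
  exact hM _ (Finset.mem_union_right _ (Finset.mem_image_of_mem _ hl))

end SpectralCalculus

/-! ### Positive definite Hermitian matrices -/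

section RealForms

variable {B : Type} [NormedDivisionRing B] [NormedAlgebra ℝ B] [StarRing B] [StarModule ℝ B]
  [FiniteDimensional ℝ B] [RealPart B] {n : ℕ}

/-- The real bilinear form `Re (v* P w)` of a matrix `P`. -/
noncomputable def reForm (P : Matrix (Fin n) (Fin n) B) : LinearMap.BilinForm ℝ (Fin n → B) :=
  LinearMap.mk₂ ℝ (fun v w => RealPart.re (form P v w))
    (fun v v' w => by simp [form, add_dotProduct])
    (fun r v w => by simp [form, smul_dotProduct])
    (fun v w w' => by simp [form, Matrix.mulVec_add, dotProduct_add])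
    (fun r v w => by simp [form, Matrix.mulVec_smul, dotProduct_smul])

theorem reForm_apply (P : Matrix (Fin n) (Fin n) B) (v w : Fin n → B) :
    reForm P v w = RealPart.re (form P v w) := rfl

theorem reForm_mulVec_right (P X : Matrix (Fin n) (Fin n) B) (v w : Fin n → B) :
    reForm P v (X *ᵥ w) = reForm (P * X) v w := by
  simp only [reForm_apply, form, Matrix.mulVec_mulVec]

theorem reForm_mulVec_left (P X : Matrix (Fin n) (Fin n) B) (v w : Fin n → B) :
    reForm P (X *ᵥ v) w = reForm (Xᴴ * P) v w := by
  simp only [reForm_apply, form, Matrix.star_mulVec, ← Matrix.dotProduct_mulVec,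
    Matrix.mulVec_mulVec]

theorem star_form (P : Matrix (Fin n) (Fin n) B) (v w : Fin n → B) :
    star (form P v w) = form Pᴴ w v := by
  simp only [form]
  rw [← Matrix.star_dotProduct_star, star_star, Matrix.star_mulVec, ← Matrix.dotProduct_mulVec]

theorem reForm_swap (hB : IsBase B) (P : Matrix (Fin n) (Fin n) B) (v w : Fin n → B) :
    reForm P v w = reForm Pᴴ w v := by
  rw [reForm_apply, ← re_star hB, star_form, reForm_apply]

theorem reForm_add (P P' : Matrix (Fin n) (Fin n) B) (v w : Fin n → B) :
    reForm (P + P') v w = reForm P v w + reForm P' v w := by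
  simp [reForm_apply, form, Matrix.add_mulVec, dotProduct_add]

theorem reForm_neg (P : Matrix (Fin n) (Fin n) B) (v w : Fin n → B) :
    reForm (-P) v w = -reForm P v w := by
  simp [reForm_apply, form, Matrix.neg_mulVec]

theorem reForm_smul (r : ℝ) (P : Matrix (Fin n) (Fin n) B) (v w : Fin n → B) :
    reForm (r • P) v w = r * reForm P v w := by
  simp [reForm_apply, form, Matrix.smul_mulVec, dotProduct_smul]

theorem reForm_sum {ι : Type*} (s : Finset ι) (P : ι → Matrix (Fin n) (Fin n) B)
    (v w : Fin n → B) : reForm (∑ i ∈ s, P i) v w = ∑ i ∈ s, reForm (P i) v w := by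
  classical
  induction s using Finset.induction_on with
  | empty => simp [reForm_apply, form]
  | insert a s ha ih => rw [Finset.sum_insert ha, Finset.sum_insert ha, reForm_add, ih]

/-- Matrices over `B`, acting on columns, as real linear operators. -/
noncomputable def realEnd : Matrix (Fin n) (Fin n) B →ₐ[ℝ] Module.End ℝ (Fin n → B) :=
  AlgHom.ofLinearMap
    { toFun := fun X =>
        { toFun := fun v => X *ᵥ v
          map_add' := Matrix.mulVec_add X
          map_smul' := fun r v => Matrix.mulVec_smul X r v }
      map_add' := fun X Y => LinearMap.ext fun v => Matrix.add_mulVec X Y v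
      map_smul' := fun r X => LinearMap.ext fun v => Matrix.smul_mulVec r X v }
    (LinearMap.ext fun v => Matrix.one_mulVec v)
    (fun X Y => LinearMap.ext fun v => (Matrix.mulVec_mulVec v X Y).symm)

theorem realEnd_apply (X : Matrix (Fin n) (Fin n) B) (v : Fin n → B) : realEnd X v = X *ᵥ v := rfl

theorem realEnd_injective : Function.Injective (realEnd (B := B) (n := n)) := by
  intro X Y h
  refine Matrix.ext_of_mulVec_single fun j => ?_
  exact LinearMap.congr_fun h (Pi.single j 1)

theorem trace_realEnd (hB : IsBase B) (X : Matrix (Fin n) (Fin n) B) :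
    LinearMap.trace ℝ (Fin n → B) (realEnd X) =
      Module.finrank ℝ B * RealPart.re (Matrix.trace X) := by
  induction X using Matrix.induction_on' with
  | h_zero => simp
  | h_add p q hp hq => rw [map_add, map_add, hp, hq, Matrix.trace_add, map_add, mul_add]
  | h_std_basis i j b =>
    let f : B →ₗ[ℝ] (Fin n → B) := (LinearMap.single ℝ (fun _ => B) i).comp (LinearMap.mulLeft ℝ b)
    let g : (Fin n → B) →ₗ[ℝ] B := LinearMap.proj j
    have h1 : realEnd (Matrix.single i j b) = f.comp g := by
      refine LinearMap.ext fun v => ?_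
      change Matrix.single i j b *ᵥ v = Pi.single i (b * v j)
      exact Matrix.single_mulVec i j b v
    rw [h1, LinearMap.trace_comp_comm']
    by_cases hij : i = j
    · subst hij
      have h2 : g.comp f = LinearMap.mulLeft ℝ b := by
        ext c
        change (Pi.single i (b * c) : Fin n → B) i = b * c
        simp
      rw [h2, trace_mulLeft hB, Matrix.trace_single_eq_same]
    · have h2 : g.comp f = 0 := by
        ext c
        change (Pi.single i (b * c) : Fin n → B) j = 0
        simp [Ne.symm hij]
      rw [h2, map_zero, Matrix.trace_single_eq_of_ne _ _ _ hij, map_zero, mul_zero]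

/-- If `S` is self-adjoint for the form with Gram matrix `P`, so are its real polynomials. -/
theorem aeval_adjoint {P S : Matrix (Fin n) (Fin n) B} (hS : P * S = Sᴴ * P)
    (p : Polynomial ℝ) : P * Polynomial.aeval S p = (Polynomial.aeval S p)ᴴ * P := by
  rw [semiconj_aeval hS]
  congr 1
  induction p using Polynomial.induction_on' with
  | add p q hp hq => rw [map_add, map_add, Matrix.conjTranspose_add, hp, hq]
  | monomial k a =>
    simp only [Polynomial.aeval_monomial, ← Algebra.smul_def, Matrix.conjTranspose_smul,
      Matrix.conjTranspose_pow, star_trivial]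

theorem spectralFun_adjoint {P S : Matrix (Fin n) (Fin n) B} (hS : P * S = Sᴴ * P)
    (Λ : Finset ℝ) (f : ℝ → ℝ) :
    P * spectralFun Λ S f = (spectralFun Λ S f)ᴴ * P :=
  aeval_adjoint hS _

theorem spectralProj_adjoint {P S : Matrix (Fin n) (Fin n) B} (hS : P * S = Sᴴ * P)
    (Λ : Finset ℝ) (l : ℝ) :
    P * spectralProj Λ S l = (spectralProj Λ S l)ᴴ * P :=
  aeval_adjoint hS _

/-- `P` is the Gram matrix of a positive definite Hermitian form on `Bⁿ`. -/
def IsPositive (P : Matrix (Fin n) (Fin n) B) : Prop :=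
  Pᴴ = P ∧ ∀ v, v ≠ 0 → 0 < reForm P v v

namespace IsPositive

variable {P : Matrix (Fin n) (Fin n) B} (hP : IsPositive P)

include hP

theorem symm (hB : IsBase B) (v w : Fin n → B) : reForm P v w = reForm P w v := by
  rw [reForm_swap hB, hP.1]

theorem nonneg (v : Fin n → B) : 0 ≤ reForm P v v := by
  by_cases h : v = 0
  · simp [h]
  · exact (hP.2 v h).le

theorem cauchySchwarz (hB : IsBase B) (v w : Fin n → B) :
    reForm P v w ^ 2 ≤ reForm P v v * reForm P w w :=
  LinearMap.BilinForm.apply_sq_le_of_symm _ hP.nonneg ⟨hP.symm hB⟩ v w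

omit hP in
theorem symmetric_realEnd {S : Matrix (Fin n) (Fin n) B} (hS : P * S = Sᴴ * P)
    (v w : Fin n → B) : reForm P (realEnd S v) w = reForm P v (realEnd S w) := by
  rw [realEnd_apply, realEnd_apply, reForm_mulVec_left, reForm_mulVec_right, hS]

/-- The spectral theorem for matrices `S` that are self-adjoint for a positive definite form. -/
theorem exists_nodal (hB : IsBase B) {S : Matrix (Fin n) (Fin n) B} (hS : P * S = Sᴴ * P) :
    ∃ Λ : Finset ℝ, Polynomial.aeval S (Lagrange.nodal Λ id) = 0 ∧
      ∀ l ∈ Λ, ∃ v, v ≠ 0 ∧ S *ᵥ v = l • v := by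
  obtain ⟨Λ, h1, h2⟩ := exists_aeval_nodal_eq_zero (reForm P) (hP.symm hB) hP.2 (realEnd S)
    (symmetric_realEnd hS)
  refine ⟨Λ, realEnd_injective ?_, h2⟩
  rw [map_zero, ← h1, Polynomial.aeval_algHom_apply]

/-- The trace form is positive definite on self-adjoint matrices. -/
theorem traceForm_self (hB : IsBase B) {S : Matrix (Fin n) (Fin n) B} (hS : P * S = Sᴴ * P) :
    0 ≤ traceForm S S ∧ (traceForm S S = 0 → S = 0) := by
  have h := trace_mul_self_of_symmetric (reForm P) (hP.symm hB) hP.2 (realEnd S)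
    (symmetric_realEnd hS)
  rw [← map_mul, trace_realEnd hB] at h
  have hd : (0 : ℝ) < Module.finrank ℝ B := by exact_mod_cast Module.finrank_pos
  refine ⟨nonneg_of_mul_nonneg_right h.1 hd, fun h0 => realEnd_injective ?_⟩
  rw [h.2, map_zero]
  exact mul_eq_zero_of_right _ h0

variable {S : Matrix (Fin n) (Fin n) B} {Λ : Finset ℝ}

/-- A lower bound for `f` on the spectrum bounds the form of `f(S)` from below: each spectral
projection, being self-adjoint and idempotent, has a nonnegative form. -/
theorem le_reForm_spectralFun (hS : P * S = Sᴴ * P)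
    (hΛ : Polynomial.aeval S (Lagrange.nodal Λ id) = 0) {f : ℝ → ℝ} {c : ℝ}
    (hf : ∀ l ∈ Λ, c ≤ f l) (v : Fin n → B) :
    c * reForm P v v ≤ reForm (P * spectralFun Λ S f) v v := by
  have hE : ∀ l ∈ Λ, 0 ≤ reForm (P * spectralProj Λ S l) v v := by
    intro l hl
    rw [← spectralProj_mul_self hΛ hl, ← mul_assoc, spectralProj_adjoint hS, mul_assoc,
      ← reForm_mulVec_left, ← reForm_mulVec_right]
    exact hP.nonneg _
  have h1 : reForm P v v = ∑ l ∈ Λ, reForm (P * spectralProj Λ S l) v v := by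
    rw [← reForm_sum, ← Finset.mul_sum]
    have := spectralFun_one hΛ
    rw [spectralFun_eq_sum] at this
    simp only [one_smul] at this
    rw [this, mul_one]
  rw [spectralFun_eq_sum, Finset.mul_sum, reForm_sum, h1, Finset.mul_sum]
  refine Finset.sum_le_sum fun l hl => ?_
  rw [mul_smul_comm, reForm_smul]
  exact mul_le_mul_of_nonneg_right (hf l hl) (hE l hl)

theorem reForm_spectralFun_pos (hS : P * S = Sᴴ * P)
    (hΛ : Polynomial.aeval S (Lagrange.nodal Λ id) = 0) {f : ℝ → ℝ}
    (hf : ∀ l ∈ Λ, 0 < f l) (v : Fin n → B) (hv : v ≠ 0) :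
    0 < reForm (P * spectralFun Λ S f) v v := by
  obtain ⟨c, hc, h⟩ : ∃ c, 0 < c ∧ ∀ l ∈ Λ, c ≤ f l := by
    by_cases h0 : Λ.Nonempty
    · obtain ⟨l, hl, hmin⟩ := Λ.exists_min_image f h0
      exact ⟨f l, hf l hl, hmin⟩
    · rw [Finset.not_nonempty_iff_eq_empty] at h0
      exact ⟨1, one_pos, by simp [h0]⟩
  exact lt_of_lt_of_le (mul_pos hc (hP.2 v hv)) (hP.le_reForm_spectralFun hS hΛ h v)

end IsPositive

end RealForms

/-! ### Lengths of geodesics -/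

section Geodesics

variable {B : Type} [NormedDivisionRing B] [NormedAlgebra ℝ B] [StarRing B] [StarModule ℝ B]
  [FiniteDimensional ℝ B] [RealPart B] {n : ℕ} {H : Matrix (Fin n) (Fin n) B}

theorem mulVec_mulVec_of_mem {I : Matrix (Fin n) (Fin n) B} (hI : I ∈ symmetricSpace H)
    (v : Fin n → B) : I *ᵥ (I *ᵥ v) = -v := by
  rw [Matrix.mulVec_mulVec, hI.1, Matrix.neg_mulVec, Matrix.one_mulVec]

/-- A point of the symmetric space, being an isometry with square `-1`, is skew-adjoint. -/
theorem conjTranspose_mul_of_mem {I : Matrix (Fin n) (Fin n) B} (hI : I ∈ symmetricSpace H) :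
    Iᴴ * H = -(H * I) := by
  have h : Iᴴ * H * I * I = H * I := by rw [hI.2.1]
  rw [mul_assoc, hI.1, mul_neg, mul_one] at h
  rw [← h, neg_neg]

/-- The majorant attached to a point of the symmetric space is positive definite. -/
theorem isPositive_of_mem (hH : Hᴴ = -H) {I : Matrix (Fin n) (Fin n) B}
    (hI : I ∈ symmetricSpace H) : IsPositive (H * I) := by
  refine ⟨?_, fun v hv => ?_⟩
  · rw [Matrix.conjTranspose_mul, hH, mul_neg, conjTranspose_mul_of_mem hI, neg_neg]
  · rw [← reForm_mulVec_right]
    exact hI.2.2 v hv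

theorem riemDist_nonneg (A : Set (Matrix (Fin n) (Fin n) B)) (z : Matrix (Fin n) (Fin n) B) :
    0 ≤ riemDist H A z := by
  refine Real.sInf_nonneg ?_
  rintro _ ⟨γ, -, -, -, -, rfl⟩
  exact intervalIntegral.integral_nonneg zero_le_one fun t _ => Real.sqrt_nonneg _

/-- A curve of constant speed `c` on the unit interval bounds the distance by `c`. -/
theorem riemDist_le {A : Set (Matrix (Fin n) (Fin n) B)} {z : Matrix (Fin n) (Fin n) B}
    {γ : ℝ → Matrix (Fin n) (Fin n) B} (h1 : ∀ i j, ContDiff ℝ 1 (fun t => γ t i j))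
    (h2 : ∀ t, γ t ∈ symmetricSpace H) (h3 : γ 0 ∈ A) (h4 : γ 1 = z) {c : ℝ}
    (h5 : ∀ t, Real.sqrt (traceForm (velocity γ t) (velocity γ t)) = c) : riemDist H A z ≤ c := by
  refine csInf_le ⟨0, ?_⟩ ⟨γ, h1, fun t _ => h2 t, h3, h4, ?_⟩
  · rintro _ ⟨γ, -, -, -, -, rfl⟩
    exact intervalIntegral.integral_nonneg zero_le_one fun t _ => Real.sqrt_nonneg _
  · simp [h5]

theorem riemDist_eq_zero_of_mem {A : Set (Matrix (Fin n) (Fin n) B)}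
    {z : Matrix (Fin n) (Fin n) B} (hz : z ∈ symmetricSpace H) (hA : z ∈ A) :
    riemDist H A z = 0 := by
  refine le_antisymm (riemDist_le (γ := fun _ => z) (fun i j => contDiff_const) (fun _ => hz) hA rfl
    fun t => ?_) (riemDist_nonneg A z)
  have : velocity (fun _ => z) t = 0 := by
    have h : (Matrix.of fun i j => deriv (fun _ : ℝ => z i j) t) = 0 := by
      ext i j; simp
    rw [velocity, h, zero_mul, smul_zero]
  rw [this]
  simp [traceForm]

/-- For an operator `S` that is symmetric for a positive definite form, with spectrum in
`[1/K, K]`, the squared trace norm of `log S` is at most `n (log K)²`. -/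
theorem IsPositive.traceForm_log_le (hB : IsBase B) {P S : Matrix (Fin n) (Fin n) B}
    (hP : IsPositive P) (hS : P * S = Sᴴ * P) {Λ : Finset ℝ}
    (hΛ : Polynomial.aeval S (Lagrange.nodal Λ id) = 0) {K : ℝ}
    (hK : ∀ l ∈ Λ, 0 < l ∧ l ≤ K ∧ l⁻¹ ≤ K) :
    traceForm (spectralFun Λ S Real.log) (spectralFun Λ S Real.log) ≤ n * Real.log K ^ 2 := by
  -- the traces of the spectral projections are nonnegative and add up to `n`
  have h1 : ∑ l ∈ Λ, RealPart.re (Matrix.trace (spectralProj Λ S l)) = n := by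
    rw [← map_sum, ← Matrix.trace_sum]
    have := spectralFun_one hΛ
    rw [spectralFun_eq_sum] at this
    simp only [one_smul] at this
    rw [this, Matrix.trace_one, Fintype.card_fin, ← nsmul_one, map_nsmul, re_one hB]
    simp
  have h2 : ∀ l ∈ Λ, 0 ≤ RealPart.re (Matrix.trace (spectralProj Λ S l)) := by
    intro l hl
    have := (hP.traceForm_self hB (spectralProj_adjoint hS Λ l)).1
    rwa [traceForm, spectralProj_mul_self hΛ hl] at this
  rw [traceForm, spectralFun_mul hΛ, spectralFun_eq_sum, Matrix.trace_sum, map_sum, ← h1,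
    Finset.sum_mul]
  refine Finset.sum_le_sum fun l hl => ?_
  rw [Matrix.trace_smul, map_smul, smul_eq_mul, mul_comm]
  refine mul_le_mul_of_nonneg_left ?_ (h2 l hl)
  obtain ⟨hl0, hlK, hlK'⟩ := hK l hl
  have h3 := Real.log_le_log hl0 hlK
  have h4 := Real.log_le_log (inv_pos.2 hl0) hlK'
  rw [Real.log_inv] at h4
  nlinarith

/-- Two points `J`, `I` of the symmetric space are joined by the curve `t ↦ J S ^ t`, where
`S = J⁻¹ I`; it has the constant velocity `-(1/2) log S`, and the eigenvalues of `S` lie in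
`[1/K, K]` if the majorant of `I` is at most `K` times that of `J`. -/
theorem riemDist_le_log (hB : IsBase B) (hH : Hᴴ = -H) {A : Set (Matrix (Fin n) (Fin n) B)}
    {I J : Matrix (Fin n) (Fin n) B} (hI : I ∈ symmetricSpace H) (hJ : J ∈ symmetricSpace H)
    (hJA : J ∈ A) {K : ℝ} (hK1 : 1 ≤ K)
    (hK : ∀ v, reForm (H * I) v v ≤ K * reForm (H * J) v v) :
    riemDist H A I ≤ Real.sqrt n / 2 * Real.log K := by
  have hP := isPositive_of_mem hH hJ
  have hI1 := hI.1
  have hJ1 := hJ.1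
  set S := -(J * I) with hSdef
  have hPS : H * J * S = H * I := by
    rw [hSdef, mul_neg, mul_assoc, ← mul_assoc J, hJ1, neg_one_mul, mul_neg, neg_neg]
  have hS : H * J * S = Sᴴ * (H * J) := by
    rw [hPS, hSdef, Matrix.conjTranspose_neg, Matrix.conjTranspose_mul, neg_mul, mul_assoc,
      ← mul_assoc Jᴴ, hJ.2.1, conjTranspose_mul_of_mem hI, neg_neg]
  have hJS : J * S = I := by rw [hSdef, mul_neg, ← mul_assoc, hJ1, neg_one_mul, neg_neg]
  have hSI : S * I = J := by rw [hSdef, neg_mul, mul_assoc, hI1, mul_neg, mul_one, neg_neg]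
  obtain ⟨Λ, hΛ, heig⟩ := hP.exists_nodal hB hS
  have hbound : ∀ l v, v ≠ 0 → S *ᵥ v = l • v → 0 < l ∧ l ≤ K := by
    intro l v hv h
    have h1 : l * reForm (H * J) v v = reForm (H * I) v v := by
      rw [← hPS, ← reForm_mulVec_right (H * J) S, h, map_smul, smul_eq_mul]
    have h2 := hP.2 v hv
    have h3 := (isPositive_of_mem hH hI).2 v hv
    refine ⟨?_, ?_⟩
    · rw [← h1] at h3
      exact pos_of_mul_pos_left h3 h2.le
    · have := hK v
      rw [← h1] at this
      exact le_of_mul_le_mul_right this h2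
  -- `J` maps eigenvectors of `S` for `l` to eigenvectors for `l⁻¹`
  have hΛK : ∀ l ∈ Λ, 0 < l ∧ l ≤ K ∧ l⁻¹ ≤ K := by
    intro l hl
    obtain ⟨v, hv, h⟩ := heig l hl
    obtain ⟨h1, h2⟩ := hbound l v hv h
    refine ⟨h1, h2, (hbound l⁻¹ (J *ᵥ v) ?_ ?_).2⟩
    · intro h0
      have := mulVec_mulVec_of_mem hJ v
      rw [h0, Matrix.mulVec_zero, eq_comm, neg_eq_zero] at this
      exact hv this
    · have h3 : S *ᵥ (J *ᵥ (S *ᵥ v)) = J *ᵥ v := by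
        rw [Matrix.mulVec_mulVec, Matrix.mulVec_mulVec, mul_assoc, hJS, hSI]
      rw [h, Matrix.mulVec_smul, Matrix.mulVec_smul] at h3
      conv_rhs => rw [← h3, smul_smul, inv_mul_cancel₀ h1.ne', one_smul]
  have hinv : J * S = spectralFun Λ S (fun l => l⁻¹) * J := by
    have h1 : spectralFun Λ S (fun l => l⁻¹) * S = 1 := by
      conv_lhs => arg 2; rw [← spectralFun_id hΛ]
      rw [spectralFun_mul hΛ, ← spectralFun_one hΛ]
      exact spectralFun_congr fun l hl => inv_mul_cancel₀ (hΛK l hl).1.ne'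
    conv_rhs => rw [← hSI]
    rw [← mul_assoc, h1, one_mul, hJS]
  have hconj : ∀ f : ℝ → ℝ, J * spectralFun Λ S f * J = -spectralFun Λ S (fun l => f l⁻¹) :=
    fun f => by
      rw [mul_spectralFun_of_inv hΛ hinv, mul_assoc, hJ1, mul_neg, mul_one]
  -- the powers `S ^ t`
  set F : ℝ → Matrix (Fin n) (Fin n) B :=
    fun t => spectralFun Λ S (fun l => Real.exp (t * Real.log l)) with hF
  have hFJ : ∀ t, J * F t * J = -F (-t) := by
    intro t
    rw [hF, hconj]
    congr 1
    exact spectralFun_congr fun l _ => by rw [Real.log_inv, mul_neg, neg_mul]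
  have hFF : ∀ t, F (-t) * F t = 1 := by
    intro t
    rw [hF, spectralFun_mul hΛ, ← spectralFun_one hΛ]
    exact spectralFun_congr fun l _ => by rw [← Real.exp_add]; simp
  have hFsum : ∀ t i j, (J * F t) i j =
      ∑ l ∈ Λ, Real.exp (t * Real.log l) • (J * spectralProj Λ S l) i j := by
    intro t i j
    rw [hF]
    simp only [spectralFun_eq_sum, Finset.mul_sum, Matrix.sum_apply, mul_smul_comm,
      Matrix.smul_apply]
  have hderiv : ∀ t i j, HasDerivAt (fun s => (J * F s) i j)
      ((J * spectralFun Λ S (fun l => Real.exp (t * Real.log l) * Real.log l)) i j) t := by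
    intro t i j
    simp only [hFsum, spectralFun_eq_sum, Finset.mul_sum, Matrix.sum_apply, mul_smul_comm,
      Matrix.smul_apply]
    refine HasDerivAt.fun_sum fun l _ => ?_
    have h1 : HasDerivAt (fun s : ℝ => Real.exp (s * Real.log l))
        (Real.exp (t * Real.log l) * Real.log l) t := by
      simpa using ((hasDerivAt_id t).mul_const (Real.log l)).exp
    exact h1.smul_const _
  -- `J S ^ t J = -S ^ (-t)`, so the factor `S ^ t log S` of the derivative becomes `log S`
  have hvel : ∀ t, velocity (fun s => J * F s) t = (-(1 / 2 : ℝ)) • spectralFun Λ S Real.log := by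
    intro t
    have h1 : (Matrix.of fun i j => deriv (fun s => (J * F s) i j) t) =
        J * spectralFun Λ S (fun l => Real.exp (t * Real.log l) * Real.log l) := by
      ext i j
      exact (hderiv t i j).deriv
    rw [velocity, h1]
    congr 1
    rw [← mul_assoc, hconj, hF, neg_mul, spectralFun_mul hΛ, spectralFun_eq_sum,
      spectralFun_eq_sum, ← Finset.sum_neg_distrib]
    refine Finset.sum_congr rfl fun l _ => ?_
    rw [← neg_smul, Real.log_inv]
    congr 1
    have : Real.exp (t * -Real.log l) * Real.exp (t * Real.log l) = 1 := by
      rw [← Real.exp_add]; simp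
    linear_combination Real.log l * this
  have hle := hP.traceForm_log_le hB hS hΛ hΛK
  have hK0 : 0 ≤ Real.log K := Real.log_nonneg hK1
  refine (riemDist_le (γ := fun t => J * F t) (fun i j => ?_) (fun t => ⟨?_, ?_, fun v hv => ?_⟩) ?_
    ?_ (c := Real.sqrt (1 / 4 * traceForm (spectralFun Λ S Real.log) (spectralFun Λ S Real.log)))
    fun t => ?_).trans ?_
  · simp only [hFsum]
    fun_prop
  · rw [← mul_assoc, hFJ, neg_mul, hFF]
  · have h1 : H = -(H * J * J) := by rw [mul_assoc, hJ1, mul_neg, mul_one, neg_neg]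
    have h2 : J * F t = F (-t) * J := by
      have := congrArg (· * J) (hFJ t)
      simp only [mul_assoc, hJ1, mul_neg, mul_one, neg_mul, neg_inj] at this
      exact this
    have hFt : F t * F (-t) = 1 := by simpa using hFF (-t)
    calc (J * F t)ᴴ * H * (J * F t) = (F t)ᴴ * (Jᴴ * H * J) * F t := by
          rw [Matrix.conjTranspose_mul]; simp only [mul_assoc]
      _ = (F t)ᴴ * H * F t := by rw [hJ.2.1]
      _ = -((F t)ᴴ * (H * J) * (J * F t)) := by
          conv_lhs => rw [h1]
          simp only [mul_assoc, mul_neg, neg_mul]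
      _ = -(H * J * (F t * F (-t)) * J) := by
          rw [h2, ← spectralFun_adjoint hS]; simp only [hF, mul_assoc]
      _ = H := by rw [hFt, mul_one, ← h1]
  · change 0 < reForm H v ((J * F t) *ᵥ v)
    rw [reForm_mulVec_right, ← mul_assoc]
    exact hP.reForm_spectralFun_pos hS hΛ (fun l _ => Real.exp_pos _) v hv
  · have : F 0 = 1 := by
      rw [hF, ← spectralFun_one hΛ]
      exact spectralFun_congr fun l _ => by simp
    simpa [this] using hJA
  · have : F 1 = S := by
      conv_rhs => rw [← spectralFun_id hΛ (S := S)]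
      exact spectralFun_congr fun l hl => by rw [one_mul, Real.exp_log (hΛK l hl).1]
    simp only [this, hJS]
  · rw [hvel, traceForm, traceForm, smul_mul_smul_comm, Matrix.trace_smul, map_smul, smul_eq_mul]
    norm_num
  · refine (Real.sqrt_le_sqrt ?_).trans_eq (Real.sqrt_sq (by positivity :
      0 ≤ Real.sqrt n / 2 * Real.log K))
    rw [mul_pow, div_pow, Real.sq_sqrt (Nat.cast_nonneg n)]
    linarith

end Geodesics

/-! ### A point of the special subspace close to a given point -/

section SpecialPoint

variable {B : Type} [NormedDivisionRing B] [NormedAlgebra ℝ B] [StarRing B] [StarModule ℝ B]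
  [FiniteDimensional ℝ B] [RealPart B] {n m : ℕ} {H : Matrix (Fin n) (Fin n) B}

/-- `p` is an orthogonal projection for the skew Hermitian form, and `Z` is a point of the
symmetric space of its range, extended by zero to the orthogonal complement. -/
structure IsPartialStructure (H p Z : Matrix (Fin n) (Fin n) B) : Prop where
  idem : p * p = p
  adj : pᴴ * H = H * p
  left : p * Z = Z
  right : Z * p = Z
  sq : Z * Z = -p
  skew : Zᴴ * H = -(H * Z)
  pos : ∀ v, p *ᵥ v = v → v ≠ 0 → 0 < reForm H v (Z *ᵥ v)

/-- If `S` acts as the identity on the range of `p` and `f 1 = 1`, so does `f(S)`. The value `1` is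
added to the nodes because it need not belong to `Λ` (when `p = 0`). -/
theorem spectralFun_mul_of_mul_eq {R : Type*} [Ring R] [Algebra ℝ R] {Λ : Finset ℝ} {S p : R}
    (hS : Polynomial.aeval S (Lagrange.nodal Λ id) = 0) (hp : S * p = p) {f : ℝ → ℝ}
    (hf : f 1 = 1) : spectralFun Λ S f * p = p := by
  classical
  have h1 : ∀ q : Polynomial ℝ, Polynomial.aeval S q * p = (q.eval 1) • p := by
    intro q
    induction q using Polynomial.induction_on' with
    | add q r hq hr => rw [map_add, add_mul, hq, hr, Polynomial.eval_add, add_smul]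
    | monomial k a =>
      have : ∀ k : ℕ, S ^ k * p = p := fun k => by
        induction k with
        | zero => rw [pow_zero, one_mul]
        | succ k ih => rw [pow_succ, mul_assoc, hp, ih]
      rw [Polynomial.aeval_monomial, mul_assoc, this, ← Algebra.smul_def]
      simp
  rw [spectralFun_eq_aeval hS (p := Lagrange.interpolate (insert 1 Λ) id f)
    fun l hl => eval_interpolate_id f (Finset.mem_insert_of_mem hl), h1,
    eval_interpolate_id f (Finset.mem_insert_self 1 Λ), hf, one_smul]

namespace IsPartialStructure

variable {p Z I : Matrix (Fin n) (Fin n) B} (hpZ : IsPartialStructure H p Z)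

include hpZ

/-- The range of `Z` lies in that of the orthogonal projection `p`. -/
theorem reForm_proj (v : Fin n → B) (y : Fin n → B) :
    reForm H (Z *ᵥ v) (p *ᵥ y) = reForm H (Z *ᵥ v) y := by
  have h : Z *ᵥ v = p *ᵥ (Z *ᵥ v) := by rw [Matrix.mulVec_mulVec, hpZ.left]
  conv_rhs => rw [h]
  rw [reForm_mulVec_left H p (Z *ᵥ v), hpZ.adj, reForm_mulVec_right]

theorem reForm_left (v w : Fin n → B) :
    reForm H (Z *ᵥ v) w = -reForm H v (Z *ᵥ w) := by
  rw [reForm_mulVec_left, reForm_mulVec_right, hpZ.skew, reForm_neg]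

/-- If the majorant of `I` is at most `κ` times that of `Z` on the range of `p`, then the
complementary projection `1 - p` has norm at most `1 + κ` for the majorant of `I`: the component
`p y` is detected by pairing `y` with `Z p y`. -/
theorem majorant_compl_le (hB : IsBase B) (hH : Hᴴ = -H) (hI : I ∈ symmetricSpace H) {κ : ℝ}
    (hκ1 : 1 ≤ κ) (hκ : ∀ v, p *ᵥ v = v → reForm (H * I) v v ≤ κ * reForm H v (Z *ᵥ v))
    (y : Fin n → B) :
    reForm (H * I) ((1 - p) *ᵥ y) ((1 - p) *ᵥ y) ≤ (1 + κ) ^ 2 * reForm (H * I) y y := by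
  have hP := isPositive_of_mem hH hI
  set u := p *ᵥ y with hu
  have hpu : p *ᵥ u = u := by rw [hu, Matrix.mulVec_mulVec, hpZ.idem]
  have hpZu : p *ᵥ (Z *ᵥ u) = Z *ᵥ u := by rw [Matrix.mulVec_mulVec, hpZ.left]
  have hZZ : Z *ᵥ (Z *ᵥ u) = -u := by
    rw [Matrix.mulVec_mulVec, hpZ.sq, Matrix.neg_mulVec, hpu]
  set a := reForm H u (Z *ᵥ u) with ha
  have ha' : a = -reForm H (Z *ᵥ u) u := by
    rw [ha, hpZ.reForm_left, neg_neg]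
  have ha0 : 0 ≤ a := by
    by_cases h : u = 0
    · rw [ha, h]; simp
    · exact (hpZ.pos u hpu h).le
  have h1 : reForm H (Z *ᵥ u) u = reForm H (Z *ᵥ u) y := hpZ.reForm_proj u y
  have h2 : reForm H (Z *ᵥ u) y = -reForm (H * I) (Z *ᵥ u) (I *ᵥ y) := by
    rw [← reForm_mulVec_right, mulVec_mulVec_of_mem hI, map_neg, neg_neg]
  have h3 : reForm (H * I) (I *ᵥ y) (I *ᵥ y) = reForm (H * I) y y := by
    rw [reForm_mulVec_left, reForm_mulVec_right, ← mul_assoc, hI.2.1]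
  have h4 := hP.cauchySchwarz hB (Z *ᵥ u) (I *ᵥ y)
  rw [h3] at h4
  have h5 : reForm (H * I) (Z *ᵥ u) (Z *ᵥ u) ≤ κ * a := by
    refine (hκ _ hpZu).trans_eq ?_
    rw [hZZ, map_neg, ha']
  have h6 : a = reForm (H * I) (Z *ᵥ u) (I *ᵥ y) := by rw [ha', h1, h2, neg_neg]
  have hy0 := hP.nonneg y
  rw [← h6] at h4
  have h7 : a ≤ κ * reForm (H * I) y y := by
    by_cases h : a = 0
    · rw [h]; positivity
    · have : a * a ≤ a * (κ * reForm (H * I) y y) := by nlinarith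
      exact le_of_mul_le_mul_left this (lt_of_le_of_ne ha0 (Ne.symm h))
  have h8 : reForm (H * I) u u ≤ κ ^ 2 * reForm (H * I) y y := by
    have := hκ u hpu
    nlinarith
  have h9 := hP.cauchySchwarz hB y u
  have h10 : |reForm (H * I) y u| ≤ κ * reForm (H * I) y y :=
    abs_le_of_sq_le_sq (by nlinarith) (by positivity)
  have h11 : (1 - p) *ᵥ y = y - u := by rw [Matrix.sub_mulVec, Matrix.one_mulVec]
  rw [h11]
  simp only [map_sub, LinearMap.sub_apply]
  rw [hP.symm hB u y]
  have := (abs_le.1 h10).1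
  nlinarith

/-- A point `J` of the symmetric space that extends `Z` and whose majorant is comparable with that
of `I`: the unitary part, in a polar decomposition, of the operator that is `Z` on the range of `p`
and the compression of `I` on the orthogonal complement. -/
theorem exists_point (hB : IsBase B) (hH : Hᴴ = -H) (hI : I ∈ symmetricSpace H) {κ : ℝ}
    (hκ1 : 1 ≤ κ) (hκ : ∀ v, p *ᵥ v = v → reForm (H * I) v v ≤ κ * reForm H v (Z *ᵥ v)) :
    ∃ J ∈ symmetricSpace H, J * p = Z ∧ p * J = J * p ∧
      ∀ v, reForm (H * I) v v ≤ 4 * κ ^ 2 * reForm (H * J) v v := by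
  have hP := isPositive_of_mem hH hI
  set q := 1 - p with hq
  have hqp : q * p = 0 := by rw [hq, sub_mul, one_mul, hpZ.idem, sub_self]
  have hpq : p * q = 0 := by rw [hq, mul_sub, mul_one, hpZ.idem, sub_self]
  have hqq : q * q = q := by rw [hq, mul_sub, mul_one, ← hq, hqp, sub_zero]
  have hqadj : qᴴ * H = H * q := by
    rw [hq, Matrix.conjTranspose_sub, Matrix.conjTranspose_one, sub_mul, one_mul, hpZ.adj,
      mul_sub, mul_one]
  have hqZ : q * Z = 0 := by rw [hq, sub_mul, one_mul, hpZ.left, sub_self]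
  obtain ⟨N, hN⟩ : ∃ N, N = Z + q * I * q := ⟨_, rfl⟩
  obtain ⟨Q, hQ⟩ : ∃ Q, Q = H * N := ⟨_, rfl⟩
  have hpN : p * N = Z := by
    rw [hN, mul_add, hpZ.left, ← mul_assoc, ← mul_assoc, hpq, zero_mul, zero_mul, add_zero]
  have hNp : N * p = Z := by
    rw [hN, add_mul, hpZ.right, mul_assoc, hqp, mul_zero, add_zero]
  have hNZ : N * Z = -p := by
    rw [hN, add_mul, hpZ.sq, mul_assoc, hqZ, mul_zero, add_zero]
  have hNskew : Nᴴ * H = -(H * N) := by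
    rw [hN, Matrix.conjTranspose_add, add_mul, hpZ.skew, Matrix.conjTranspose_mul,
      Matrix.conjTranspose_mul, mul_assoc, mul_assoc, hqadj, ← mul_assoc Iᴴ,
      conjTranspose_mul_of_mem hI, neg_mul, mul_neg, ← mul_assoc, ← mul_assoc, hqadj, mul_add,
      neg_add]
    simp only [mul_assoc]
  -- the form `Q` is the sum of the majorants of `Z` and of `I` on the two summands
  have hQeval : ∀ v, reForm Q v v = reForm H (p *ᵥ v) (Z *ᵥ (p *ᵥ v)) +
      reForm (H * I) (q *ᵥ v) (q *ᵥ v) := by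
    intro v
    rw [hQ, hN, mul_add, reForm_add]
    congr 1
    · rw [reForm_mulVec_left, reForm_mulVec_right, reForm_mulVec_right, hpZ.adj, mul_assoc H p,
        hpZ.left, mul_assoc, hpZ.right]
    · rw [reForm_mulVec_left, reForm_mulVec_right, ← mul_assoc qᴴ, hqadj]
      simp only [mul_assoc]
  have hterm : ∀ v, 0 ≤ reForm H (p *ᵥ v) (Z *ᵥ (p *ᵥ v)) := by
    intro v
    by_cases h : p *ᵥ v = 0
    · rw [h]; simp
    · exact (hpZ.pos _ (by rw [Matrix.mulVec_mulVec, hpZ.idem]) h).le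
  have hdecomp : ∀ v, p *ᵥ v + q *ᵥ v = v := by
    intro v
    rw [← Matrix.add_mulVec, hq, add_sub_cancel, Matrix.one_mulVec]
  have hQpos : IsPositive Q := by
    refine ⟨?_, fun v hv => ?_⟩
    · rw [hQ, Matrix.conjTranspose_mul, hH, mul_neg, hNskew, neg_neg]
    · rw [hQeval]
      by_cases h : p *ᵥ v = 0
      · have h1 := hdecomp v
        rw [h, zero_add] at h1
        rw [h1]
        exact add_pos_of_nonneg_of_pos (hterm v) (hP.2 v hv)
      · exact add_pos_of_pos_of_nonneg
          (hpZ.pos _ (by rw [Matrix.mulVec_mulVec, hpZ.idem]) h) (hP.nonneg _)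
  -- `T = -N²` is self-adjoint and positive for `Q`, and the point sought is `N T ^ (-1/2)`
  obtain ⟨T, hT⟩ : ∃ T, T = -(N * N) := ⟨_, rfl⟩
  have hQN : Nᴴ * Q = -(Q * N) := by
    rw [hQ, ← mul_assoc, hNskew, neg_mul]
  have hQT' : Q * T = Nᴴ * Q * N := by rw [hT, mul_neg, hQN, neg_mul, mul_assoc]
  have hQT : Q * T = Tᴴ * Q := by
    have : Tᴴ = -(Nᴴ * Nᴴ) := by
      rw [hT, Matrix.conjTranspose_neg, Matrix.conjTranspose_mul]
    rw [this, neg_mul, mul_assoc, hQN, mul_neg, ← mul_assoc, hQN, hT]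
    simp only [mul_neg, neg_mul, neg_neg, mul_assoc]
  obtain ⟨Λ, hΛ, heig⟩ := hQpos.exists_nodal hB hQT
  -- `N` is bounded by `1 + κ` for the form `Q`
  have hNle : ∀ v, reForm Q (N *ᵥ v) (N *ᵥ v) ≤ (1 + κ) ^ 2 * reForm Q v v := by
    intro v
    have hpNv : p *ᵥ (N *ᵥ v) = Z *ᵥ (p *ᵥ v) := by
      rw [Matrix.mulVec_mulVec, hpN, Matrix.mulVec_mulVec, hpZ.right]
    have hqNv : q *ᵥ (N *ᵥ v) = q *ᵥ (I *ᵥ (q *ᵥ v)) := by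
      rw [Matrix.mulVec_mulVec, Matrix.mulVec_mulVec, Matrix.mulVec_mulVec, hN, mul_add, hqZ,
        zero_add]
      simp only [← mul_assoc, hqq]
    rw [hQeval, hQeval, hpNv, hqNv]
    have h1 : reForm H (Z *ᵥ (p *ᵥ v)) (Z *ᵥ (Z *ᵥ (p *ᵥ v))) =
        reForm H (p *ᵥ v) (Z *ᵥ (p *ᵥ v)) := by
      have hZZ : Z *ᵥ (Z *ᵥ (p *ᵥ v)) = -(p *ᵥ v) := by
        rw [Matrix.mulVec_mulVec, hpZ.sq, Matrix.neg_mulVec, Matrix.mulVec_mulVec, hpZ.idem]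
      rw [hZZ, map_neg, hpZ.reForm_left, neg_neg]
    have h2 := hpZ.majorant_compl_le hB hH hI hκ1 hκ (I *ᵥ (q *ᵥ v))
    have h3 : reForm (H * I) (I *ᵥ (q *ᵥ v)) (I *ᵥ (q *ᵥ v)) =
        reForm (H * I) (q *ᵥ v) (q *ᵥ v) := by
      rw [reForm_mulVec_left, reForm_mulVec_right, ← mul_assoc, hI.2.1]
    rw [h3] at h2
    rw [h1, mul_add]
    exact add_le_add (le_mul_of_one_le_left (hterm v) (by nlinarith)) h2
  have hΛ' : ∀ l ∈ Λ, 0 < l ∧ l ≤ (1 + κ) ^ 2 := by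
    intro l hl
    obtain ⟨v, hv, h⟩ := heig l hl
    have h1 : l * reForm Q v v = reForm Q (N *ᵥ v) (N *ᵥ v) := by
      rw [reForm_mulVec_left, reForm_mulVec_right, ← hQT', ← reForm_mulVec_right, h, map_smul,
        smul_eq_mul]
    have h2 := hQpos.2 v hv
    have hNv : N *ᵥ v ≠ 0 := by
      intro h0
      rw [hQ, ← reForm_mulVec_right, h0, map_zero] at h2
      exact lt_irrefl _ h2
    have h3 := hQpos.2 _ hNv
    refine ⟨pos_of_mul_pos_left (by rwa [h1]) h2.le, ?_⟩
    have h4 := hNle v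
    rw [← h1] at h4
    exact le_of_mul_le_mul_right h4 h2
  obtain ⟨R, hR⟩ : ∃ R, R = spectralFun Λ T (fun l => (Real.sqrt l)⁻¹) := ⟨_, rfl⟩
  have hNT : N * T = T * N := by rw [hT, mul_neg, neg_mul, mul_assoc]
  have hNR : N * R = R * N := hR ▸ semiconj_aeval hNT _
  have hpT : p * T = T * p := by
    have hZN : Z * N = N * Z := by rw [← hNp, mul_assoc, hpN, hNp]
    rw [hT, mul_neg, neg_mul, ← mul_assoc, hpN, mul_assoc, hNp, hZN]
  have hpR : p * R = R * p := hR ▸ semiconj_aeval hpT _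
  have hTp : T * p = p := by rw [hT, neg_mul, mul_assoc, hNp, hNZ, neg_neg]
  have hRp : R * p = p := hR ▸ spectralFun_mul_of_mul_eq hΛ hTp (by simp)
  have hTRR : T * (R * R) = 1 := by
    conv_lhs => arg 1; rw [← spectralFun_id hΛ (S := T)]
    rw [hR, spectralFun_mul hΛ, spectralFun_mul hΛ, ← spectralFun_one hΛ]
    refine spectralFun_congr fun l hl => ?_
    have h0 := (hΛ' l hl).1
    rw [← mul_inv, Real.mul_self_sqrt h0.le, mul_inv_cancel₀ h0.ne']
  have hRadj : Rᴴ * Q = Q * R := hR ▸ (spectralFun_adjoint hQT Λ _).symm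
  have hκ0 : 0 < 1 + κ := by linarith
  -- the majorant of `N R` is the form of `T ^ (-1/2)`, and `T ≤ (1 + κ)²`
  have hlow : ∀ v, (1 + κ)⁻¹ * reForm Q v v ≤ reForm (H * (N * R)) v v := by
    intro v
    rw [← mul_assoc, ← hQ, hR]
    refine hQpos.le_reForm_spectralFun hQT hΛ (fun l hl => ?_) v
    obtain ⟨h0, h1⟩ := hΛ' l hl
    refine inv_anti₀ (Real.sqrt_pos.2 h0) ?_
    rw [← Real.sqrt_sq hκ0.le]
    exact Real.sqrt_le_sqrt h1
  refine ⟨N * R, ⟨?_, ?_, fun v hv => ?_⟩, ?_, ?_, fun v => ?_⟩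
  · rw [mul_assoc, ← mul_assoc R, ← hNR, ← hTRR, hT]
    simp only [mul_assoc, neg_mul, neg_neg]
  · calc (N * R)ᴴ * H * (N * R) = Rᴴ * (Nᴴ * H) * (N * R) := by
          rw [Matrix.conjTranspose_mul]; simp only [mul_assoc]
      _ = -(Rᴴ * Q * (N * R)) := by rw [hNskew, ← hQ, mul_neg, neg_mul]
      _ = H * (-(N * N) * (R * R)) := by
          rw [hRadj, hQ, mul_assoc, ← mul_assoc R, ← hNR]
          simp only [mul_assoc, neg_mul, mul_neg]
      _ = H := by rw [← hT, hTRR, mul_one]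
  · change 0 < reForm H v ((N * R) *ᵥ v)
    rw [reForm_mulVec_right]
    exact lt_of_lt_of_le (mul_pos (inv_pos.2 hκ0) (hQpos.2 v hv)) (hlow v)
  · rw [mul_assoc, hRp, hNp]
  · rw [← mul_assoc, hpN, ← hNp, mul_assoc, hpR, mul_assoc]
  · have h1 : reForm (H * I) v v ≤ 2 * κ * reForm Q v v := by
      have h2 := hκ (p *ᵥ v) (by rw [Matrix.mulVec_mulVec, hpZ.idem])
      have h3 : reForm (H * I) v v ≤ 2 * reForm (H * I) (p *ᵥ v) (p *ᵥ v) +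
          2 * reForm (H * I) (q *ᵥ v) (q *ᵥ v) := by
        have h4 := hP.nonneg (p *ᵥ v - q *ᵥ v)
        conv_lhs => rw [← hdecomp v]
        simp only [map_sub, LinearMap.sub_apply, map_add, LinearMap.add_apply] at h4 ⊢
        linarith
      rw [hQeval]
      have := hP.nonneg (q *ᵥ v)
      nlinarith
    have h2 := hlow v
    rw [inv_mul_le_iff₀ hκ0] at h2
    have h3 : 0 ≤ reForm (H * (N * R)) v v :=
      le_trans (mul_nonneg (inv_nonneg.2 hκ0.le) (hQpos.nonneg v)) (hlow v)
    calc reForm (H * I) v v ≤ 2 * κ * ((1 + κ) * reForm (H * (N * R)) v v) := by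
          refine h1.trans (mul_le_mul_of_nonneg_left h2 (by linarith))
      _ ≤ _ := by
          rw [← mul_assoc]
          exact mul_le_mul_of_nonneg_right (by nlinarith) h3

end IsPartialStructure

end SpecialPoint

/-! ### Non-degenerate subspaces -/

section Subspaces

variable {B : Type} [NormedDivisionRing B] [NormedAlgebra ℝ B] [StarRing B] [StarModule ℝ B]
  [FiniteDimensional ℝ B] [RealPart B] {n m : ℕ} {H : Matrix (Fin n) (Fin n) B}

theorem form_smul_right (P : Matrix (Fin n) (Fin n) B) (v w : Fin n → B) (b : B) :
    form P v (MulOpposite.op b • w) = form P v w * b := by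
  simp only [form, Matrix.mulVec_smul, dotProduct_smul, op_smul_eq_mul]

theorem form_smul_left (P : Matrix (Fin n) (Fin n) B) (v w : Fin n → B) (b : B) :
    form P (MulOpposite.op b • v) w = star b * form P v w := by
  rw [← star_star (form P (MulOpposite.op b • v) w), star_form, form_smul_right, star_mul,
    star_form, Matrix.conjTranspose_conjTranspose]

theorem form_mulVec_right (P X : Matrix (Fin n) (Fin n) B) (v w : Fin n → B) :
    form P v (X *ᵥ w) = form (P * X) v w := by
  simp only [form, Matrix.mulVec_mulVec]

theorem form_mulVec_left (P X : Matrix (Fin n) (Fin n) B) (v w : Fin n → B) :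
    form P (X *ᵥ v) w = form (Xᴴ * P) v w := by
  simp only [form, Matrix.star_mulVec, ← Matrix.dotProduct_mulVec, Matrix.mulVec_mulVec]

theorem form_ext {P Q : Matrix (Fin n) (Fin n) B} (h : ∀ v w, form P v w = form Q v w) :
    P = Q := by
  ext i j
  have := h (Pi.single i 1) (Pi.single j 1)
  simpa [form, ← Pi.single_star, single_dotProduct] using this

theorem form_skew (hH : Hᴴ = -H) (v w : Fin n → B) : form H v w = -star (form H w v) := by
  rw [star_form, hH]
  simp [form, Matrix.neg_mulVec]

theorem form_sub_right (P : Matrix (Fin n) (Fin n) B) (v w w' : Fin n → B) :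
    form P v (w - w') = form P v w - form P v w' := by
  simp only [form, Matrix.mulVec_sub, dotProduct_sub]

/-- Orthogonality for the real part of the form is orthogonality for the form. -/
theorem mem_orthogonal_of_reForm (hB : IsBase B) {U : Submodule Bᵐᵒᵖ (Fin n → B)} {v : Fin n → B}
    (h : ∀ u ∈ U, reForm H u v = 0) : v ∈ orthogonal H U := by
  intro u hu
  by_contra h0
  have h1 := h _ (U.smul_mem (MulOpposite.op (form H u v)) hu)
  rw [reForm_apply, form_smul_left] at h1
  exact (re_star_mul_self_pos hB h0).ne' h1

/-- Reduction to the real part of the form, a reflexive real bilinear form. -/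
theorem isCompl_orthogonal (hB : IsBase B) (hH : Hᴴ = -H) {U : Submodule Bᵐᵒᵖ (Fin n → B)}
    (hU : Nondegenerate H U) : IsCompl U (orthogonal H U) := by
  have hdisj : ∀ v ∈ U, v ∈ orthogonal H U → v = 0 := by
    intro v hv hv'
    refine hU v hv fun w hw => ?_
    rw [form_skew hH, hv' w hw, star_zero, neg_zero]
  have hrefl : LinearMap.IsRefl (reForm H) := by
    intro v w h
    rw [reForm_swap hB, hH, reForm_neg, h, neg_zero]
  have h1 : IsCompl (U.restrictScalars ℝ)
      (LinearMap.BilinForm.orthogonal (reForm H) (U.restrictScalars ℝ)) := by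
    rw [LinearMap.BilinForm.isCompl_orthogonal_iff_disjoint hrefl, Submodule.disjoint_def]
    exact fun v hv hv' => hdisj v hv (mem_orthogonal_of_reForm hB fun u hu => hv' u hu)
  refine ⟨Submodule.disjoint_def.2 hdisj, Submodule.codisjoint_iff_exists_add_eq.2 fun v => ?_⟩
  obtain ⟨u, w, hu, hw, h⟩ := Submodule.codisjoint_iff_exists_add_eq.1 h1.2 v
  exact ⟨u, w, hu, mem_orthogonal_of_reForm hB fun u hu => hw u hu, h⟩

omit [StarRing B] [StarModule ℝ B] [FiniteDimensional ℝ B] [RealPart B] in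
theorem exists_matrix_mulVec (f : (Fin n → B) →ₗ[Bᵐᵒᵖ] (Fin n → B)) :
    ∃ X : Matrix (Fin n) (Fin n) B, ∀ v, X *ᵥ v = f v := by
  refine ⟨Matrix.of fun i j => f (Pi.single j 1) i, fun v => ?_⟩
  have hv : v = ∑ j, MulOpposite.op (v j) • (Pi.single j 1 : Fin n → B) := by
    ext i
    simp [Finset.sum_apply, Pi.single_apply]
  conv_rhs => rw [hv, map_sum]
  ext i
  simp only [Finset.sum_apply, map_smul, Pi.smul_apply, op_smul_eq_mul]
  rfl

/-- The orthogonal projection on a non-degenerate subspace, and a point of its symmetric space, as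
matrices. -/
theorem exists_isPartialStructure (hB : IsBase B) (hH : Hᴴ = -H)
    {U : Submodule Bᵐᵒᵖ (Fin n → B)} (hU : Nondegenerate H U) {z' : U →ₗ[Bᵐᵒᵖ] U}
    (hz' : z' ∈ subspaceSymmetricSpace H U) :
    ∃ p Z : Matrix (Fin n) (Fin n) B, IsPartialStructure H p Z ∧ (∀ v, p *ᵥ v ∈ U) ∧
      (∀ v ∈ U, p *ᵥ v = v) ∧ (∀ v ∈ orthogonal H U, p *ᵥ v = 0) ∧
      (∀ v, p *ᵥ v = 0 → v ∈ orthogonal H U) ∧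
      ∀ u : U, Z *ᵥ (u : Fin n → B) = (z' u : Fin n → B) := by
  have hc := isCompl_orthogonal hB hH hU
  let pr := Submodule.projectionOnto U (orthogonal H U) hc
  obtain ⟨p, hp⟩ := exists_matrix_mulVec (U.subtype ∘ₗ pr)
  obtain ⟨Z, hZ⟩ := exists_matrix_mulVec (U.subtype ∘ₗ z' ∘ₗ pr)
  have hp' : ∀ v, p *ᵥ v = (pr v : Fin n → B) := hp
  have hZ' : ∀ v, Z *ᵥ v = (z' (pr v) : Fin n → B) := hZ
  have hpr : ∀ u : U, pr u = u := fun u => Submodule.projectionOnto_apply_left hc u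
  have hpr0 : ∀ v, pr v = 0 ↔ v ∈ orthogonal H U := fun v =>
    Submodule.projectionOnto_apply_eq_zero_iff hc
  have hsub : ∀ v, v - (pr v : Fin n → B) ∈ orthogonal H U := by
    intro v
    rw [← hpr0, map_sub, hpr, sub_self]
  have hform : ∀ (u : U) (v : Fin n → B), form H u v = form H u (pr v : Fin n → B) := by
    intro u v
    have := hsub v u u.2
    rwa [form_sub_right, sub_eq_zero] at this
  have hform' : ∀ (v : Fin n → B) (u : U), form H v u = form H (pr v : Fin n → B) u := by
    intro v u
    rw [form_skew hH, hform, ← form_skew hH]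
  have hext : ∀ {X Y : Matrix (Fin n) (Fin n) B}, (∀ v, X *ᵥ v = Y *ᵥ v) → X = Y := fun h =>
    realEnd_injective (LinearMap.ext h)
  obtain ⟨hz1, hz2, hz3⟩ := hz'
  have hz2' : ∀ u w : U, form H (z' u : Fin n → B) (z' w : Fin n → B) = form H u w := hz2
  refine ⟨p, Z, ⟨?_, ?_, ?_, ?_, ?_, ?_, ?_⟩, ?_, ?_, ?_, ?_, ?_⟩
  · refine hext fun v => ?_
    rw [← Matrix.mulVec_mulVec, hp', hp', hpr]
  · refine form_ext fun v w => ?_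
    rw [← form_mulVec_left, ← form_mulVec_right, hp', hp', hform, ← hform']
  · refine hext fun v => ?_
    rw [← Matrix.mulVec_mulVec, hZ', hp', hpr]
  · refine hext fun v => ?_
    rw [← Matrix.mulVec_mulVec, hp', hZ', hZ', hpr]
  · refine hext fun v => ?_
    rw [← Matrix.mulVec_mulVec, hZ', hZ', hpr, Matrix.neg_mulVec, hp', hz1, Submodule.coe_neg]
  · refine form_ext fun v w => ?_
    have h1 : form (-(H * Z)) v w = -form H v (Z *ᵥ w) := by
      rw [form_mulVec_right]; simp [form, Matrix.neg_mulVec]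
    have h2 := hz2' (pr v) (z' (pr w))
    rw [hz1, Submodule.coe_neg] at h2
    rw [h1, ← form_mulVec_left, hZ', hZ', hform, hform' v, ← h2]
    simp [form, Matrix.mulVec_neg]
  · intro v hv hv0
    rw [hp'] at hv
    have hne : pr v ≠ 0 := fun h => hv0 (by rw [← hv, h, Submodule.coe_zero])
    have h1 : 0 < RealPart.re (form H (pr v : Fin n → B) (z' (pr v) : Fin n → B)) :=
      hz3 (pr v) hne
    rw [reForm_apply, hZ']
    rwa [hv] at h1
  · intro v; rw [hp']; exact (pr v).2
  · intro v hv; rw [hp', hpr ⟨v, hv⟩]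
  · intro v hv; rw [hp', (hpr0 v).2 hv, Submodule.coe_zero]
  · intro v hv
    rw [hp'] at hv
    exact (hpr0 v).1 (Subtype.ext hv)
  · intro u; rw [hZ', hpr]

/-- A point of `D` that restricts to `z'` on `U` and preserves `U^⊥` lies in `D_{U,z'}`. -/
theorem mem_specialSubspace {U : Submodule Bᵐᵒᵖ (Fin n → B)}
    {z' : U →ₗ[Bᵐᵒᵖ] U} {J : Matrix (Fin n) (Fin n) B} (hJ : J ∈ symmetricSpace H)
    (h1 : ∀ u : U, J *ᵥ (u : Fin n → B) = (z' u : Fin n → B))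
    (h2 : ∀ v ∈ orthogonal H U, J *ᵥ v ∈ orthogonal H U) : J ∈ specialSubspace H U z' := by
  let w : orthogonal H U →ₗ[Bᵐᵒᵖ] orthogonal H U :=
    { toFun := fun v => ⟨J *ᵥ (v : Fin n → B), h2 v v.2⟩
      map_add' := fun v v' => Subtype.ext (Matrix.mulVec_add J _ _)
      map_smul' := fun b v => Subtype.ext (Matrix.mulVec_smul J b _) }
  refine ⟨hJ, w, ⟨fun v => Subtype.ext ?_, fun v v' => ?_, fun v hv => ?_⟩, h1, fun v => rfl⟩
  · exact mulVec_mulVec_of_mem hJ v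
  · change form H (J *ᵥ (v : Fin n → B)) (J *ᵥ (v' : Fin n → B)) = form H v v'
    rw [form_mulVec_left, form_mulVec_right, hJ.2.1]
  · exact hJ.2.2 v fun h => hv (Subtype.ext h)

/-- Homogeneity under scalars in `B`; the value `form P v v` is real because `P` is Hermitian. -/
theorem IsPositive.reForm_smul (hB : IsBase B) {P : Matrix (Fin n) (Fin n) B} (hP : IsPositive P)
    (v : Fin n → B) (b : B) :
    reForm P (MulOpposite.op b • v) (MulOpposite.op b • v) = reForm P v v * ‖b‖ ^ 2 := by
  obtain ⟨r, hr⟩ := exists_algebraMap_of_star_eq_self hB (a := form P v v)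
    (by rw [star_form, hP.1])
  rw [reForm_apply, reForm_apply, form_smul_left, form_smul_right, hr, ← re_star_mul_self hB,
    Algebra.algebraMap_eq_smul_one, smul_mul_assoc, one_mul, mul_smul_comm, map_smul, map_smul,
    re_one hB, smul_eq_mul, smul_eq_mul, mul_one]

theorem IsPositive.reForm_sum_le (hB : IsBase B) {P : Matrix (Fin n) (Fin n) B}
    (hP : IsPositive P) (v : Fin m → Fin n → B) :
    reForm P (∑ l, v l) (∑ l, v l) ≤ m * ∑ l, reForm P (v l) (v l) := by
  have h : ∀ a b, reForm P a b ≤ (reForm P a a + reForm P b b) / 2 := by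
    intro a b
    have := hP.nonneg (a - b)
    simp only [map_sub, LinearMap.sub_apply] at this
    rw [hP.symm hB b a] at this
    linarith
  calc reForm P (∑ l, v l) (∑ l, v l) = ∑ k, ∑ l, reForm P (v k) (v l) := by
        simp only [map_sum, LinearMap.sum_apply]
        exact Finset.sum_comm
    _ ≤ ∑ k, ∑ l, (reForm P (v k) (v k) + reForm P (v l) (v l)) / 2 :=
        Finset.sum_le_sum fun k _ => Finset.sum_le_sum fun l _ => h _ _
    _ = m * ∑ l, reForm P (v l) (v l) := by
        simp only [← Finset.sum_div, Finset.sum_add_distrib, Finset.sum_const, Finset.card_univ,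
          Fintype.card_fin, nsmul_eq_mul, ← Finset.mul_sum]
        ring

end Subspaces

/-! ### Growth of the majorant -/

section Growth

variable {B : Type} [NormedDivisionRing B] [NormedAlgebra ℝ B] [StarRing B] [StarModule ℝ B]
  [FiniteDimensional ℝ B] [RealPart B] {n m : ℕ} {H : Matrix (Fin n) (Fin n) B}

theorem majorant_eq_reForm (z : Matrix (Fin n) (Fin n) B) (v : Fin n → B) :
    majorant H z v = reForm (H * z) v v := by
  rw [← reForm_mulVec_right]; rfl

theorem majorant_inv_mulVec {g : (Matrix (Fin n) (Fin n) B)ˣ} (hg : g ∈ isometryGroup H)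
    (z₀ : Matrix (Fin n) (Fin n) B) (v : Fin n → B) :
    majorant H z₀ ((g⁻¹ : (Matrix (Fin n) (Fin n) B)ˣ) *ᵥ v) = majorant H (act g z₀) v := by
  have h : ((g⁻¹ : (Matrix (Fin n) (Fin n) B)ˣ) : Matrix (Fin n) (Fin n) B)ᴴ * H =
      H * (g : Matrix (Fin n) (Fin n) B) := by
    have h0 : (g : Matrix (Fin n) (Fin n) B)ᴴ * H * (g : Matrix (Fin n) (Fin n) B) = H := hg
    conv_lhs => rw [← h0]
    rw [← mul_assoc, ← mul_assoc, ← Matrix.conjTranspose_mul, Units.mul_inv,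
      Matrix.conjTranspose_one, one_mul]
  rw [majorant_eq_reForm, majorant_eq_reForm, reForm_mulVec_left, reForm_mulVec_right,
    ← mul_assoc, h, act]
  simp only [mul_assoc]

/-- The sum `M(z, x)` does not depend on the base point. -/
theorem majorantSum_eq {g : (Matrix (Fin n) (Fin n) B)ˣ} (hg : g ∈ isometryGroup H)
    {z₀ z : Matrix (Fin n) (Fin n) B} (hz : act g z₀ = z) (x : Fin m → Fin n → B) :
    majorantSum H z₀ g x = ∑ l, majorant H z (x l) := by
  rw [← hz]
  exact Finset.sum_congr rfl fun l _ => majorant_inv_mulVec hg z₀ (x l)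

/-- On the span of the `x l`, the majorant of any point `I` is bounded by `M(I, x)` times a fixed
positive definite form. -/
theorem exists_majorant_le (hB : IsBase B) (hH : Hᴴ = -H) (x : Fin m → Fin n → B)
    {U : Submodule Bᵐᵒᵖ (Fin n → B)} (hU : U = Submodule.span Bᵐᵒᵖ (Set.range x))
    {p Z : Matrix (Fin n) (Fin n) B} (hpZ : IsPartialStructure H p Z) (hpU : ∀ v ∈ U, p *ᵥ v = v) :
    ∃ C : ℝ, 0 < C ∧ ∀ I ∈ symmetricSpace H, ∀ v ∈ U,
      reForm (H * I) v v ≤ C * (∑ l, majorant H I (x l)) * reForm H v (Z *ᵥ v) := by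
  -- the coordinate map `b ↦ ∑ x_l b_l` onto `U`, and a real linear section `s` of it
  let g : (Fin m → B) →ₗ[ℝ] (Fin n → B) :=
    { toFun := fun b => ∑ l, MulOpposite.op (b l) • x l
      map_add' := fun b c => by
        simp only [Pi.add_apply, MulOpposite.op_add, add_smul, Finset.sum_add_distrib]
      map_smul' := fun r b => by
        simp only [Pi.smul_apply, MulOpposite.op_smul, smul_assoc, Finset.smul_sum,
          RingHom.id_apply] }
  have hgU : ∀ v, v ∈ LinearMap.range g ↔ v ∈ U := by
    intro v
    rw [hU, Submodule.mem_span_range_iff_exists_fun]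
    constructor
    · rintro ⟨b, rfl⟩
      exact ⟨fun l => MulOpposite.op (b l), rfl⟩
    · rintro ⟨b, rfl⟩
      exact ⟨fun l => MulOpposite.unop (b l), rfl⟩
  obtain ⟨s, hs⟩ := LinearMap.exists_rightInverse_of_surjective g.rangeRestrict g.range_rangeRestrict
  have hs' : ∀ v : LinearMap.range g, g (s v) = v := fun v =>
    congrArg Subtype.val (LinearMap.congr_fun hs v)
  have hsymm : ∀ v w, reForm (H * Z) v w = reForm (H * Z) w v := by
    intro v w
    rw [reForm_swap hB, Matrix.conjTranspose_mul, hH, mul_neg, hpZ.skew, neg_neg]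
  obtain ⟨C, hC, hle⟩ := exists_norm_sq_le ((reForm (H * Z)).restrict (LinearMap.range g))
    (fun v w => hsymm v w) (fun v hv => by
      have hv' : (v : Fin n → B) ≠ 0 := fun h => hv (Subtype.ext h)
      have := hpZ.pos v (hpU v ((hgU v).1 v.2)) hv'
      rwa [reForm_mulVec_right] at this) s
  refine ⟨(m + 1) * C, by positivity, fun I hI v hv => ?_⟩
  have hP := isPositive_of_mem hH hI
  set b := s ⟨v, (hgU v).2 hv⟩ with hb
  have h1 : v = ∑ l, MulOpposite.op (b l) • x l := (hs' ⟨v, (hgU v).2 hv⟩).symm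
  have h2 : ‖b‖ ^ 2 ≤ C * reForm H v (Z *ᵥ v) := by
    rw [reForm_mulVec_right]
    exact hle ⟨v, (hgU v).2 hv⟩
  have h3 : ∀ l, 0 ≤ majorant H I (x l) := fun l => by
    rw [majorant_eq_reForm]; exact hP.nonneg _
  have h4 : 0 ≤ ∑ l, majorant H I (x l) := Finset.sum_nonneg fun l _ => h3 l
  calc reForm (H * I) v v
      ≤ m * ∑ l, reForm (H * I) (MulOpposite.op (b l) • x l) (MulOpposite.op (b l) • x l) := by
        conv_lhs => rw [h1]
        exact hP.reForm_sum_le hB _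
    _ ≤ m * ∑ l, majorant H I (x l) * ‖b‖ ^ 2 := by
        refine mul_le_mul_of_nonneg_left (Finset.sum_le_sum fun l _ => ?_) (Nat.cast_nonneg m)
        rw [hP.reForm_smul hB, ← majorant_eq_reForm]
        refine mul_le_mul_of_nonneg_left ?_ (h3 l)
        gcongr
        exact norm_le_pi_norm b l
    _ = m * (∑ l, majorant H I (x l)) * ‖b‖ ^ 2 := by rw [← Finset.sum_mul, mul_assoc]
    _ ≤ (m + 1) * (∑ l, majorant H I (x l)) * (C * reForm H v (Z *ᵥ v)) := by
        gcongr
        linarith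
    _ = _ := by ring

/-- Exponential growth of `M(z, x)` with the distance of `z` from `D_{U,z'}`. -/
theorem exists_exp_riemDist_le (hB : IsBase B) (hH : Hᴴ = -H) (x : Fin m → Fin n → B)
    {U : Submodule Bᵐᵒᵖ (Fin n → B)} (hU : U = Submodule.span Bᵐᵒᵖ (Set.range x))
    (hUnd : Nondegenerate H U) {z' : U →ₗ[Bᵐᵒᵖ] U} (hz' : z' ∈ subspaceSymmetricSpace H U)
    (hU0 : U ≠ ⊥) : ∃ b c : ℝ, 0 < b ∧ 0 < c ∧ ∀ z ∈ symmetricSpace H,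
      c * Real.exp (2 * b * riemDist H (specialSubspace H U z') z) ≤ ∑ l, majorant H z (x l) := by
  obtain ⟨p, Z, hpZ, hp1, hp2, hp3, hp4, hZ⟩ := exists_isPartialStructure hB hH hUnd hz'
  obtain ⟨C, hC, hle⟩ := exists_majorant_le hB hH x hU hpZ hp2
  obtain ⟨u, hu, hu0⟩ := (Submodule.ne_bot_iff U).1 hU0
  have hn : 0 < n := by
    rcases Nat.eq_zero_or_pos n with h | h
    · subst h
      exact absurd (Subsingleton.elim u 0) hu0
    · exact h
  have hsn : 0 < Real.sqrt n := Real.sqrt_pos.2 (by exact_mod_cast hn)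
  refine ⟨1 / (2 * Real.sqrt n), 1 / (2 * C), by positivity, by positivity, fun I hI => ?_⟩
  have hP := isPositive_of_mem hH hI
  set M := ∑ l, majorant H I (x l) with hM
  have hM0 : 0 ≤ M := Finset.sum_nonneg fun l _ => by
    rw [majorant_eq_reForm]; exact hP.nonneg _
  have hκ : ∀ v, p *ᵥ v = v → reForm (H * I) v v ≤ C * M * reForm H v (Z *ᵥ v) := by
    intro v hv
    exact hle I hI v (hv ▸ hp1 v)
  -- pairing `u` with `Z u` shows that the majorant of `I` cannot be small on `U`
  have hκ1 : 1 ≤ C * M := by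
    have hpu := hp2 u hu
    have ha := hpZ.pos u hpu hu0
    set a := reForm H u (Z *ᵥ u) with ha'
    have h1 := hκ u hpu
    have h2 := hκ (Z *ᵥ u) (by rw [Matrix.mulVec_mulVec, hpZ.left])
    rw [Matrix.mulVec_mulVec, hpZ.sq, Matrix.neg_mulVec, hpu, map_neg, hpZ.reForm_left, neg_neg,
      ← ha'] at h2
    have h3 := hP.cauchySchwarz hB (Z *ᵥ u) (I *ᵥ u)
    have h4 : reForm (H * I) (I *ᵥ u) (I *ᵥ u) = reForm (H * I) u u := by
      rw [reForm_mulVec_left, reForm_mulVec_right, ← mul_assoc, hI.2.1]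
    have h5 : reForm (H * I) (Z *ᵥ u) (I *ᵥ u) = a := by
      rw [← reForm_mulVec_right, mulVec_mulVec_of_mem hI, map_neg, hpZ.reForm_left, neg_neg]
    rw [h4, h5] at h3
    have hk0 : 0 ≤ C * M := by positivity
    have h6 : a ^ 2 ≤ (C * M * a) * (C * M * a) :=
      h3.trans (mul_le_mul h2 h1 (hP.nonneg _) (by positivity))
    by_contra hlt
    rw [not_le] at hlt
    nlinarith [mul_pos ha ha, mul_lt_mul'' hlt hlt hk0 hk0]
  obtain ⟨J, hJ, hJp, hpJ, hJle⟩ := hpZ.exists_point hB hH hI hκ1 hκ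
  have hJA : J ∈ specialSubspace H U z' := by
    refine mem_specialSubspace hJ (fun u => ?_) fun v hv => ?_
    · rw [← hZ u, ← hJp, ← Matrix.mulVec_mulVec, hp2 u u.2]
    · refine hp4 _ ?_
      rw [Matrix.mulVec_mulVec, hpJ, ← Matrix.mulVec_mulVec, hp3 v hv, Matrix.mulVec_zero]
  have hd := riemDist_le_log hB hH hI hJ hJA (by nlinarith : 1 ≤ 4 * (C * M) ^ 2) hJle
  have hlog : Real.log (4 * (C * M) ^ 2) = 2 * Real.log (2 * (C * M)) := by
    rw [show 4 * (C * M) ^ 2 = (2 * (C * M)) ^ 2 by ring, Real.log_pow]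
    norm_num
  rw [hlog] at hd
  have h1 : 2 * (1 / (2 * Real.sqrt n)) * riemDist H (specialSubspace H U z') I ≤
      Real.log (2 * (C * M)) := by
    rw [show 2 * (1 / (2 * Real.sqrt n)) * riemDist H (specialSubspace H U z') I =
      riemDist H (specialSubspace H U z') I / Real.sqrt n by field_simp, div_le_iff₀ hsn]
    linarith
  have h2 := Real.exp_le_exp.2 h1
  rw [Real.exp_log (by linarith)] at h2
  calc 1 / (2 * C) * _ ≤ 1 / (2 * C) * (2 * (C * M)) := by gcongr
    _ = M := by field_simp

/-- For `U = 0`, the subspace `D_{U,z'}` is the whole of `D`. -/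
theorem riemDist_eq_zero_of_eq_bot {U : Submodule Bᵐᵒᵖ (Fin n → B)} (hU0 : U = ⊥)
    (z' : U →ₗ[Bᵐᵒᵖ] U) {z : Matrix (Fin n) (Fin n) B} (hz : z ∈ symmetricSpace H) :
    riemDist H (specialSubspace H U z') z = 0 := by
  have h0 : ∀ u ∈ U, u = 0 := fun u hu => by rwa [hU0, Submodule.mem_bot] at hu
  refine riemDist_eq_zero_of_mem hz (mem_specialSubspace hz (fun u => ?_) fun v _ u hu => ?_)
  · rw [h0 u u.2, h0 _ (z' u).2, Matrix.mulVec_zero]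
  · rw [h0 u hu]
    simp [form]

end Growth

/-! ### Bounds for the Weil representation -/

section Weil

variable {B : Type} [NormedDivisionRing B] [NormedAlgebra ℝ B] [StarRing B] [StarModule ℝ B]
  [FiniteDimensional ℝ B] [RealPart B] {n m : ℕ} {H : Matrix (Fin n) (Fin n) B}

theorem pairing_eq_sum_reForm (x y : Fin m → Fin n → B) :
    pairing H x y = ∑ l, reForm H (x l) (y l) := rfl

/-- The symplectic form as a real bilinear form. -/
noncomputable def symplecticBilin (H : Matrix (Fin n) (Fin n) B) (m : ℕ) :
    LinearMap.BilinForm ℝ (BigSpace B n m) :=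
  LinearMap.mk₂ ℝ (symplecticForm H)
    (fun u v w => by
      simp only [symplecticForm, pairing_eq_sum_reForm, xPart, yPart, Pi.add_apply, map_add,
        LinearMap.add_apply, Finset.sum_add_distrib]
      ring)
    (fun r v w => by
      simp only [symplecticForm, pairing_eq_sum_reForm, xPart, yPart, Pi.smul_apply, map_smul,
        LinearMap.smul_apply, smul_eq_mul, ← Finset.mul_sum]
      ring)
    (fun u v w => by
      simp only [symplecticForm, pairing_eq_sum_reForm, xPart, yPart, Pi.add_apply, map_add,
        Finset.sum_add_distrib]
      ring)
    (fun r v w => by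
      simp only [symplecticForm, pairing_eq_sum_reForm, xPart, yPart, Pi.smul_apply, map_smul,
        smul_eq_mul, ← Finset.mul_sum]
      ring)

theorem eq_zero_of_reForm_eq_zero (hB : IsBase B) (hHunit : IsUnit H) {w : Fin n → B}
    (h : ∀ v, reForm H v w = 0) : w = 0 := by
  obtain ⟨G, hG⟩ := hHunit.exists_left_inv
  have h1 : H *ᵥ w = 0 := by
    ext i
    by_contra h0
    have := h (Pi.single i ((H *ᵥ w) i))
    rw [reForm_apply, form, ← Pi.single_star, single_dotProduct] at this
    exact (re_star_mul_self_pos hB h0).ne' this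
  rw [← Matrix.one_mulVec w, ← hG, ← Matrix.mulVec_mulVec, h1, Matrix.mulVec_zero]

/-- Non-degeneracy of the symplectic form: every linear functional on `𝕎` is represented. -/
theorem exists_symplecticForm_eq (hB : IsBase B) (hHunit : IsUnit H)
    (l : BigSpace B n m →ₗ[ℝ] ℝ) : ∃ w, ∀ u, symplecticForm H u w = l u := by
  have hinj : Function.Injective (symplecticBilin H m).flip := by
    rw [← LinearMap.ker_eq_bot, LinearMap.ker_eq_bot']
    intro w hw
    have hw' : ∀ u, symplecticForm H u w = 0 := fun u => LinearMap.congr_fun hw u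
    ext k : 1
    refine eq_zero_of_reForm_eq_zero hB hHunit fun v => ?_
    cases k with
    | inl k =>
      have := hw' (Sum.elim 0 (Pi.single k v))
      simp only [symplecticForm, pairing_eq_sum_reForm, xPart, yPart, Sum.elim_inl, Sum.elim_inr,
        Pi.zero_apply, map_zero, LinearMap.zero_apply, Finset.sum_const_zero, zero_add] at this
      rwa [Finset.sum_eq_single k (fun j _ hj => by simp [hj]) (by simp),
        Pi.single_eq_same] at this
    | inr k =>
      have := hw' (Sum.elim (Pi.single k v) 0)
      simp only [symplecticForm, pairing_eq_sum_reForm, xPart, yPart, Sum.elim_inl, Sum.elim_inr,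
        Pi.zero_apply, map_zero, LinearMap.zero_apply, Finset.sum_const_zero, add_zero] at this
      rwa [Finset.sum_eq_single k (fun j _ hj => by simp [hj]) (by simp),
        Pi.single_eq_same] at this
  have hsurj := (LinearMap.injective_iff_surjective_of_finrank_eq_finrank
    (Subspace.dual_finrank_eq (K := ℝ) (V := BigSpace B n m)).symm).1 hinj
  obtain ⟨w, hw⟩ := hsurj l
  exact ⟨w, fun u => LinearMap.congr_fun hw u⟩

/-- Every linear functional on `V^m` is a pairing, so that the coordinates of `y ∈ V^m` occur among
the multiplication operators of the Weyl algebra. -/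
theorem exists_pairing_eq (hB : IsBase B) (hHunit : IsUnit H)
    (l : (Fin m → Fin n → B) →ₗ[ℝ] ℝ) : ∃ y, ∀ x, pairing H x y = l x := by
  obtain ⟨w, hw⟩ := exists_symplecticForm_eq (m := m) hB hHunit
    (l.comp (LinearMap.funLeft ℝ (Fin n → B) Sum.inl))
  refine ⟨yPart w, fun x => ?_⟩
  have h := hw (Sum.elim x 0)
  have h0 : pairing H (yPart (Sum.elim x 0 : BigSpace B n m)) (xPart w) = 0 := by
    simp [pairing_eq_sum_reForm, yPart]
  rw [symplecticForm, h0, add_zero] at h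
  exact h

theorem weylOp_sum_smul (H : Matrix (Fin n) (Fin n) B) {ι : Type*} [Fintype ι] (c : ι → ℝ)
    (w : ι → BigSpace B n m)
    (f : 𝓢(Fin m → Fin n → B, ℂ)) :
    weylOp H (∑ a, c a • w a) f = ∑ a, c a • weylOp H (w a) f := by
  ext x
  have h1 : xPart (∑ a, c a • w a) = ∑ a, c a • xPart (w a) := by
    ext l : 1; simp [xPart]
  have h2 : pairing H x (yPart (∑ a, c a • w a)) = ∑ a, c a * pairing H x (yPart (w a)) := by
    simp only [pairing_eq_sum_reForm, yPart, Finset.sum_apply, Pi.smul_apply, map_sum, map_smul,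
      smul_eq_mul, Finset.mul_sum]
    exact Finset.sum_comm
  simp only [weylOp_apply, sum_apply, smul_apply, h1, h2, map_sum, map_smul,
    Complex.real_smul, mul_add, Finset.sum_add_distrib]
  congr 1
  push_cast
  rw [Finset.mul_sum, Finset.sum_mul]
  exact Finset.sum_congr rfl fun a _ => by ring

variable (g' : DualCover H m)

theorem dualCover_mem : g'.1 ∈ metaplecticCircle H m :=
  Subgroup.commutator_le_self _ g'.2.1

theorem l2NormSq_weil (f : 𝓢(Fin m → Fin n → B, ℂ)) : l2NormSq (weil H g' f) = l2NormSq f :=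
  congrArg Complex.re ((dualCover_mem g').2.1 f f)

/-- The intertwining property, read from left to right. -/
theorem weylOp_weil (w : BigSpace B n m) (f : 𝓢(Fin m → Fin n → B, ℂ)) :
    weylOp H w (weil H g' f) = weil H g' (weylOp H (g'.1.1.symm w) f) := by
  have := (dualCover_mem g').2.2 (g'.1.1.symm w) f
  rw [LinearEquiv.apply_symm_apply] at this
  exact this.symm

theorem symplecticForm_symm (w v : BigSpace B n m) :
    symplecticForm H (g'.1.1.symm w) v = symplecticForm H w (g'.1.1 v) := by
  have := (dualCover_mem g').1 (g'.1.1.symm w) v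
  rw [LinearEquiv.apply_symm_apply] at this
  exact this.symm

theorem continuous_dualCover_apply (v : BigSpace B n m) :
    Continuous fun g' : DualCover H m => g'.1.1 v := by
  have h : Continuous (fun g' : DualCover H m =>
      ((fun w => g'.1.1 w, fun f => l2Inner f.1 (weil H g' f.2)) :
      (BigSpace B n m → BigSpace B n m) ×
      (𝓢(Fin m → Fin n → B, ℂ) × 𝓢(Fin m → Fin n → B, ℂ) → ℂ))) := continuous_induced_dom
  exact (continuous_apply v).comp (continuous_fst.comp h)

theorem continuous_symplecticForm (w v : BigSpace B n m) :
    Continuous fun g' : DualCover H m => symplecticForm H w (g'.1.1 v) :=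
  (LinearMap.continuous_of_finiteDimensional (symplecticBilin H m w)).comp
    (continuous_dualCover_apply v)

/-- The element `ρ(w₁) ⋯ ρ(w_k)` of the Weyl algebra belonging to a word `[w₁, …, w_k]` in `𝕎`. -/
noncomputable def weylWord (H : Matrix (Fin n) (Fin n) B) (L : List (BigSpace B n m)) :
    𝓢(Fin m → Fin n → B, ℂ) →L[ℂ] 𝓢(Fin m → Fin n → B, ℂ) :=
  (L.map (weylOp H)).prod

theorem weylWord_append (L L' : List (BigSpace B n m)) (f : 𝓢(Fin m → Fin n → B, ℂ)) :
    weylWord H (L ++ L') f = weylWord H L (weylWord H L' f) := by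
  rw [weylWord, List.map_append, List.prod_append]; rfl

theorem weylWord_nil (f : 𝓢(Fin m → Fin n → B, ℂ)) : weylWord H [] f = f := rfl

theorem weylWord_singleton (w : BigSpace B n m) (f : 𝓢(Fin m → Fin n → B, ℂ)) :
    weylWord H [w] f = weylOp H w f := by
  rw [weylWord, List.map_singleton, List.prod_singleton]

theorem weylWord_replicate (w : BigSpace B n m) (K : ℕ) (f : 𝓢(Fin m → Fin n → B, ℂ)) :
    weylWord H (List.replicate K w) f = (fun f => weylOp H w f)^[K] f := by
  induction K with
  | zero => rfl
  | succ K ih =>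
    rw [List.replicate_succ, Function.iterate_succ_apply', ← ih,
      ← List.singleton_append, weylWord_append, weylWord_singleton]

/-- The `L²` norms of `ρ(w₁) ⋯ ρ(w_k) ω(g') f` are bounded locally uniformly in `g'`: moving
`ρ(w_k)` past `ω(g')` turns it into `ρ(γ⁻¹ w_k)`, whose coordinates are continuous in `g'`, and
`ω(g')` is unitary. -/
theorem exists_continuous_l2NormSq_le (hB : IsBase B) (hHunit : IsUnit H)
    (L : List (BigSpace B n m)) : ∀ f : 𝓢(Fin m → Fin n → B, ℂ),
    ∃ C : DualCover H m → ℝ, Continuous C ∧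
      ∀ g', l2NormSq (weylWord H L (weil H g' f)) ≤ C g' := by
  induction L using List.reverseRecOn with
  | nil => exact fun f => ⟨fun _ => l2NormSq f, continuous_const, fun g' => (l2NormSq_weil g' f).le⟩
  | append_singleton L w ih =>
    intro f
    let b := Module.finBasis ℝ (BigSpace B n m)
    -- the coordinates of `γ⁻¹ w` are `⟨⟨γ⁻¹ w, d a⟩⟩ = ⟨⟨w, γ (d a)⟩⟩`
    choose d hd using fun a => exists_symplecticForm_eq hB hHunit (b.coord a)
    choose C hC hle using fun a => ih (weylOp H (b a) f)
    refine ⟨fun g' => (Finset.univ : Finset (Fin (Module.finrank ℝ (BigSpace B n m)))).card *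
      ∑ a, (symplecticForm H w (g'.1.1 (d a))) ^ 2 * C a g', ?_, fun g' => ?_⟩
    · exact continuous_const.mul (continuous_finsetSum _ fun a _ =>
        ((continuous_symplecticForm w (d a)).pow 2).mul (hC a))
    · have h1 : g'.1.1.symm w = ∑ a, symplecticForm H w (g'.1.1 (d a)) • b a := by
        conv_lhs => rw [← b.sum_repr (g'.1.1.symm w)]
        refine Finset.sum_congr rfl fun a _ => ?_
        rw [← symplecticForm_symm, hd]
        rfl
      have h2 : weylWord H (L ++ [w]) (weil H g' f) =
          ∑ a, symplecticForm H w (g'.1.1 (d a)) •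
            weylWord H L (weil H g' (weylOp H (b a) f)) := by
        rw [weylWord_append, weylWord_singleton, weylOp_weil, h1, weylOp_sum_smul, map_sum,
          map_sum]
        refine Finset.sum_congr rfl fun a _ => ?_
        rw [← Complex.coe_smul, map_smul, map_smul, Complex.coe_smul]
      rw [h2]
      refine (l2NormSq_sum_le _ _).trans ?_
      refine mul_le_mul_of_nonneg_left (Finset.sum_le_sum fun a _ => ?_) (Nat.cast_nonneg _)
      rw [l2NormSq_smul]
      exact mul_le_mul_of_nonneg_left (hle a g') (sq_nonneg _)

/-- By the Sobolev inequality, the `L²` bounds for longer words give pointwise bounds. -/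
theorem exists_continuous_norm_le (hB : IsBase B) (hHunit : IsUnit H)
    (L : List (BigSpace B n m)) (f : 𝓢(Fin m → Fin n → B, ℂ)) :
    ∃ C : DualCover H m → ℝ, Continuous C ∧
      ∀ g' y, ‖weylWord H L (weil H g' f) y‖ ≤ C g' := by
  obtain ⟨N, v, K, A, hA, hsob⟩ := exists_norm_le_l2NormSq_lineDeriv (Fin m → Fin n → B)
  obtain ⟨C, hC, hle⟩ := exists_continuous_l2NormSq_le hB hHunit L f
  choose D hD hDle using fun j => exists_continuous_l2NormSq_le hB hHunit
    (List.replicate K (Sum.elim (v j) 0 : BigSpace B n m) ++ L) f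
  have hop : ∀ j, (fun f : 𝓢(Fin m → Fin n → B, ℂ) => LineDeriv.lineDerivOp (v j) f) =
      fun f => weylOp H (Sum.elim (v j) 0 : BigSpace B n m) f := by
    intro j
    ext f x
    have h1 : pairing H x (yPart (Sum.elim (v j) 0 : BigSpace B n m)) = 0 := by
      simp [pairing_eq_sum_reForm, yPart]
    rw [weylOp_apply, h1, SchwartzMap.lineDerivOp_apply_eq_fderiv]
    simp only [Complex.ofReal_zero, mul_zero, zero_mul, add_zero]
    rfl
  refine ⟨fun g' => A * (1 + C g' + ∑ j, D j g'), ?_, fun g' y => (hsob _ y).trans ?_⟩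
  · exact continuous_const.mul ((continuous_const.add hC).add
      (continuous_finsetSum _ fun j _ => hD j))
  · refine mul_le_mul_of_nonneg_left (add_le_add (add_le_add le_rfl (hle g'))
      (Finset.sum_le_sum fun j _ => ?_)) hA.le
    rw [hop, ← weylWord_replicate, ← weylWord_append]
    exact hDle j g'

theorem weylWord_replicate_mul (y₀ : Fin m → Fin n → B) (K : ℕ) (f : 𝓢(Fin m → Fin n → B, ℂ))
    (y : Fin m → Fin n → B) :
    weylWord H (List.replicate K (Sum.elim 0 y₀ : BigSpace B n m)) f y =
      (2 * Real.pi * Complex.I * (pairing H y y₀ : ℂ)) ^ K * f y := by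
  induction K with
  | zero => rw [List.replicate_zero, weylWord_nil, pow_zero, one_mul]
  | succ K ih =>
    rw [List.replicate_succ, ← List.singleton_append, weylWord_append, weylWord_singleton,
      weylOp_apply, ih]
    have h1 : xPart (Sum.elim 0 y₀ : BigSpace B n m) = 0 := rfl
    have h2 : yPart (Sum.elim 0 y₀ : BigSpace B n m) = y₀ := rfl
    rw [h1, h2, map_zero, zero_add, pow_succ]
    ring

theorem IsPositive.exists_sum_le_coord_sq (hB : IsBase B) {P : Matrix (Fin n) (Fin n) B}
    (hP : IsPositive P) {N : ℕ} (b : Module.Basis (Fin N) ℝ (Fin m → Fin n → B)) :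
    ∃ A : ℝ, 0 ≤ A ∧ ∀ y : Fin m → Fin n → B,
      ∑ l, reForm P (y l) (y l) ≤ A * ∑ a, b.coord a y ^ 2 := by
  have hAa : ∀ a, 0 ≤ ∑ l, reForm P (b a l) (b a l) := fun a =>
    Finset.sum_nonneg fun l _ => hP.nonneg _
  refine ⟨N * ∑ a, ∑ l, reForm P (b a l) (b a l),
    mul_nonneg (Nat.cast_nonneg _) (Finset.sum_nonneg fun a _ => hAa a), fun y => ?_⟩
  have hy : ∀ l, y l = ∑ a, b.coord a y • b a l := by
    intro l
    have := congrFun (b.sum_repr y) l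
    rw [Finset.sum_apply] at this
    exact this.symm
  calc ∑ l, reForm P (y l) (y l)
      ≤ ∑ l, (N : ℝ) * ∑ a, reForm P (b.coord a y • b a l) (b.coord a y • b a l) := by
        refine Finset.sum_le_sum fun l _ => ?_
        conv_lhs => rw [hy l]
        exact hP.reForm_sum_le hB _
    _ = N * ∑ a, b.coord a y ^ 2 * ∑ l, reForm P (b a l) (b a l) := by
        rw [← Finset.mul_sum, Finset.sum_comm]
        congr 1
        refine Finset.sum_congr rfl fun a _ => ?_
        rw [Finset.mul_sum]
        refine Finset.sum_congr rfl fun l _ => ?_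
        simp only [map_smul, LinearMap.smul_apply, smul_eq_mul]
        ring
    _ ≤ N * ∑ a, b.coord a y ^ 2 * ∑ a, ∑ l, reForm P (b a l) (b a l) := by
        refine mul_le_mul_of_nonneg_left (Finset.sum_le_sum fun a _ => ?_) (Nat.cast_nonneg N)
        exact mul_le_mul_of_nonneg_left (Finset.single_le_sum
          (f := fun a => ∑ l, reForm P (b a l) (b a l)) (fun a _ => hAa a) (Finset.mem_univ a))
          (sq_nonneg _)
    _ = _ := by rw [← Finset.sum_mul]; ring

theorem sum_pow_succ_le {N : ℕ} (t : Fin N → ℝ) (ht : ∀ a, 0 ≤ t a) (k : ℕ) :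
    (∑ a, t a) ^ (k + 1) ≤ N ^ k * ∑ a, t a ^ (k + 1) := by
  rcases Nat.eq_zero_or_pos N with h | h
  · subst h
    simp
  · have := pow_sum_div_card_le_sum_pow (s := (Finset.univ : Finset (Fin N)))
      (f := t) (fun a _ => ht a) k
    rw [Finset.card_univ, Fintype.card_fin, div_le_iff₀ (by positivity)] at this
    linarith

theorem sq_pow_le_norm_two_pi_I_mul_pow (t : ℝ) (k : ℕ) :
    (t ^ 2) ^ k ≤ ‖(2 * Real.pi * Complex.I * (t : ℂ)) ^ (2 * k)‖ := by
  rw [norm_pow, pow_mul]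
  refine pow_le_pow_left₀ (sq_nonneg t) ?_ k
  have h1 : (1 : ℝ) ≤ 2 ^ 2 * Real.pi ^ 2 := by nlinarith [Real.pi_gt_three]
  have h2 : ‖(2 * Real.pi * Complex.I * (t : ℂ))‖ ^ 2 = 2 ^ 2 * Real.pi ^ 2 * t ^ 2 := by
    simp [mul_pow]
  rw [h2]
  nlinarith [sq_nonneg t]

/-- Rapid decay of `ω(g') f`, locally uniformly in `g'`. -/
theorem exists_continuous_majorant_pow_mul_le (hB : IsBase B) (hHunit : IsUnit H)
    {P : Matrix (Fin n) (Fin n) B} (hP : IsPositive P) (k : ℕ) (f : 𝓢(Fin m → Fin n → B, ℂ)) :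
    ∃ C : DualCover H m → ℝ, Continuous C ∧
      ∀ g' y, (∑ l, reForm P (y l) (y l)) ^ (k + 1) * ‖weil H g' f y‖ ≤ C g' := by
  obtain ⟨N, b⟩ : ∃ N, Nonempty (Module.Basis (Fin N) ℝ (Fin m → Fin n → B)) :=
    ⟨_, ⟨Module.finBasis ℝ _⟩⟩
  obtain ⟨b⟩ := b
  choose d hd using fun a => exists_pairing_eq hB hHunit (b.coord a)
  choose C hC hle using fun a => exists_continuous_norm_le hB hHunit
    (List.replicate (2 * (k + 1)) (Sum.elim 0 (d a) : BigSpace B n m)) f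
  obtain ⟨A, hA0, hq⟩ := hP.exists_sum_le_coord_sq hB b
  refine ⟨fun g' => A ^ (k + 1) * (N ^ k * ∑ a, C a g'), ?_, fun g' y => ?_⟩
  · exact continuous_const.mul (continuous_const.mul (continuous_finsetSum _ fun a _ => hC a))
  have h2 : ∀ a, (b.coord a y ^ 2) ^ (k + 1) * ‖weil H g' f y‖ ≤ C a g' := by
    intro a
    refine le_trans ?_ (hle a g' y)
    rw [weylWord_replicate_mul, norm_mul, hd]
    exact mul_le_mul_of_nonneg_right (sq_pow_le_norm_two_pi_I_mul_pow _ _) (norm_nonneg _)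
  have hq0 : 0 ≤ ∑ l, reForm P (y l) (y l) := Finset.sum_nonneg fun l _ => hP.nonneg _
  have h3 : (∑ l, reForm P (y l) (y l)) ^ (k + 1) ≤
      A ^ (k + 1) * (N ^ k * ∑ a, (b.coord a y ^ 2) ^ (k + 1)) := by
    refine (pow_le_pow_left₀ hq0 (hq y) _).trans ?_
    rw [mul_pow]
    exact mul_le_mul_of_nonneg_left (sum_pow_succ_le _ (fun a => sq_nonneg _) k) (by positivity)
  refine (mul_le_mul_of_nonneg_right h3 (norm_nonneg _)).trans ?_
  rw [mul_assoc, mul_assoc, Finset.sum_mul]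
  exact mul_le_mul_of_nonneg_left (mul_le_mul_of_nonneg_left
    (Finset.sum_le_sum fun a _ => h2 a) (by positivity)) (by positivity)

end Weil

/-! ### Decay of translated forms -/

section Decay

variable {B : Type} [NormedDivisionRing B] [NormedAlgebra ℝ B] [StarRing B] [StarModule ℝ B]
  [FiniteDimensional ℝ B] [RealPart B] {n m : ℕ} {H : Matrix (Fin n) (Fin n) B}

theorem traceForm_comm (hB : IsBase B) (X Y : Matrix (Fin n) (Fin n) B) :
    traceForm X Y = traceForm Y X := by
  simp only [traceForm, Matrix.trace, Matrix.diag, Matrix.mul_apply, map_sum]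
  rw [Finset.sum_comm]
  exact Finset.sum_congr rfl fun i _ => Finset.sum_congr rfl fun j _ => re_mul_comm hB _ _

/-- The Riemannian metric on the tangent space `𝔭_z`: the trace form as a real bilinear form. -/
noncomputable def tangentMetric (H z : Matrix (Fin n) (Fin n) B) :
    LinearMap.BilinForm ℝ (tangent H z) :=
  LinearMap.mk₂ ℝ (fun X Y => traceForm X.1 Y.1)
    (fun X X' Y => by simp [traceForm, add_mul])
    (fun r X Y => by simp [traceForm])
    (fun X Y Y' => by simp [traceForm, mul_add])
    (fun r X Y => by simp [traceForm])

/-- Elements of `𝔭_z` are self-adjoint for the majorant of `z`. -/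
theorem tangentMetric_pos (hB : IsBase B) (hH : Hᴴ = -H) {z : Matrix (Fin n) (Fin n) B}
    (hz : z ∈ symmetricSpace H) (X : tangent H z) (hX : X ≠ 0) : 0 < tangentMetric H z X X := by
  obtain ⟨X, hX1, hX2⟩ := X
  have h1 : Xᴴ * H = -(H * X) := eq_neg_of_add_eq_zero_left hX1
  have hS : H * z * X = Xᴴ * (H * z) := by
    rw [← mul_assoc Xᴴ, h1, neg_mul, mul_assoc, mul_assoc, hX2, mul_neg, neg_neg]
  have h := (isPositive_of_mem hH hz).traceForm_self hB hS
  exact lt_of_le_of_ne h.1 fun h0 => hX (Subtype.ext (h.2 h0.symm))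

/-- `G` acts on `D` by isometries. -/
theorem traceForm_pullTangent (hB : IsBase B) {z₀ z : Matrix (Fin n) (Fin n) B}
    (g : (Matrix (Fin n) (Fin n) B)ˣ) (hgG : g ∈ isometryGroup H) (hg : act g z₀ = z)
    (X Y : tangent H z) :
    traceForm (pullTangent g hgG hg X).1 (pullTangent g hgG hg Y).1 = traceForm X.1 Y.1 := by
  have hcoe : ∀ X : tangent H z, (pullTangent g hgG hg X).1 =
      (g⁻¹ : (Matrix (Fin n) (Fin n) B)ˣ) * X.1 * g := fun _ => rfl
  have h : ((g⁻¹ : (Matrix (Fin n) (Fin n) B)ˣ) * X.1 * (g : Matrix (Fin n) (Fin n) B)) *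
      ((g⁻¹ : (Matrix (Fin n) (Fin n) B)ˣ) * Y.1 * g) =
      (g⁻¹ : (Matrix (Fin n) (Fin n) B)ˣ) * (X.1 * Y.1 * g) := by
    rw [mul_assoc _ Y.1, mul_assoc _ (g : Matrix (Fin n) (Fin n) B),
      ← mul_assoc (g : Matrix (Fin n) (Fin n) B), Units.mul_inv, one_mul]
    simp only [mul_assoc]
  have hcomm := traceForm_comm hB ((g⁻¹ : (Matrix (Fin n) (Fin n) B)ˣ) : Matrix (Fin n) (Fin n) B)
    (X.1 * Y.1 * g)
  rw [traceForm, traceForm, mul_assoc _ (g : Matrix (Fin n) (Fin n) B), Units.mul_inv, mul_one]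
    at hcomm
  rw [hcoe, hcoe, traceForm, h, hcomm, traceForm]

/-- A weighted bound for the operators `ω(g')` passes from single Schwartz functions to the values
of an alternating form on unit vectors, by expansion in a basis. -/
theorem exists_continuous_form_le (hB : IsBase B) (hH : Hᴴ = -H) {z₀ : Matrix (Fin n) (Fin n) B}
    (hz₀ : z₀ ∈ symmetricSpace H) {W : (Fin m → Fin n → B) → ℝ} (hW0 : ∀ y, 0 ≤ W y)
    (hW : ∀ f : 𝓢(Fin m → Fin n → B, ℂ), ∃ C : DualCover H m → ℝ, Continuous C ∧
      ∀ g' y, W y * ‖weil H g' f y‖ ≤ C g') {d : ℕ}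
    (φ : (tangent H z₀) [⋀^Fin d]→ₗ[ℝ] 𝓢(Fin m → Fin n → B, ℂ)) :
    ∃ C : DualCover H m → ℝ, Continuous C ∧ ∀ g' y (X : Fin d → tangent H z₀),
      (∀ i, traceForm (X i).1 (X i).1 = 1) → W y * ‖weil H g' (φ X) y‖ ≤ C g' := by
  let b := Module.finBasis ℝ (tangent H z₀)
  obtain ⟨R, hR, hle⟩ := exists_norm_sq_le (tangentMetric H z₀)
    (fun X Y => traceForm_comm hB X.1 Y.1) (tangentMetric_pos hB hH hz₀)
    b.equivFun.toLinearMap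
  choose C hC hCle using hW
  refine ⟨fun g' => ∑ r : Fin d → Fin (Module.finrank ℝ (tangent H z₀)),
    (R + 1) ^ d * C (φ fun i => b (r i)) g', ?_, fun g' y X hX => ?_⟩
  · exact continuous_finsetSum _ fun r _ => continuous_const.mul (hC _)
  have hcoord : ∀ i a, |b.equivFun (X i) a| ≤ R + 1 := by
    intro i a
    have h1 : ‖b.equivFun (X i)‖ ^ 2 ≤ R * 1 := (hle (X i)).trans_eq (by
      change R * traceForm (X i).1 (X i).1 = _
      rw [hX])
    have h2 : ‖b.equivFun (X i) a‖ ≤ ‖b.equivFun (X i)‖ := norm_le_pi_norm _ a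
    rw [Real.norm_eq_abs] at h2
    nlinarith [norm_nonneg (b.equivFun (X i))]
  have hexp : φ X = ∑ r : Fin d → Fin (Module.finrank ℝ (tangent H z₀)),
      (∏ i, b.equivFun (X i) (r i)) • φ fun i => b (r i) := by
    conv_lhs => rw [show X = fun i => ∑ a, b.equivFun (X i) a • b a from
      funext fun i => (b.sum_equivFun (X i)).symm]
    change φ.toMultilinearMap _ = _
    rw [MultilinearMap.map_sum]
    exact Finset.sum_congr rfl fun r _ => MultilinearMap.map_smul_univ _ _ _
  have hval : weil H g' (φ X) y = ∑ r : Fin d → Fin (Module.finrank ℝ (tangent H z₀)),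
      ((∏ i, b.equivFun (X i) (r i) : ℝ) : ℂ) * weil H g' (φ fun i => b (r i)) y := by
    rw [hexp, map_sum, sum_apply]
    refine Finset.sum_congr rfl fun r _ => ?_
    rw [← Complex.coe_smul, map_smul, smul_apply, smul_eq_mul]
  rw [hval]
  calc _ ≤ W y * ∑ r : Fin d → Fin (Module.finrank ℝ (tangent H z₀)),
        (R + 1) ^ d * ‖weil H g' (φ fun i => b (r i)) y‖ := by
        refine mul_le_mul_of_nonneg_left ((norm_sum_le _ _).trans
          (Finset.sum_le_sum fun r _ => ?_)) (hW0 y)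
        rw [norm_mul, Complex.norm_real, Real.norm_eq_abs, Finset.abs_prod]
        refine mul_le_mul_of_nonneg_right ?_ (norm_nonneg _)
        refine (Finset.prod_le_prod (fun i _ => abs_nonneg _) fun i _ => hcoord i (r i)).trans_eq ?_
        simp
    _ ≤ _ := by
        rw [Finset.mul_sum]
        refine Finset.sum_le_sum fun r _ => ?_
        rw [mul_left_comm]
        exact mul_le_mul_of_nonneg_left (hCle _ g' y) (by positivity)

theorem le_finrank_of_orthonormal {z : Matrix (Fin n) (Fin n) B} {N : ℕ} {e : Fin N → tangent H z}
    (he : ∀ i j, traceForm (e i).1 (e j).1 = if i = j then 1 else 0) :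
    N ≤ Module.finrank ℝ (tangent H z) := by
  have hli : LinearIndependent ℝ e := by
    rw [Fintype.linearIndependent_iff]
    intro c hc j
    have h1 : tangentMetric H z (∑ i, c i • e i) (e j) = c j := by
      have h2 : ∀ i, tangentMetric H z (e i) (e j) = if i = j then 1 else 0 := fun i => he i j
      simp only [map_sum, map_smul, LinearMap.sum_apply, LinearMap.smul_apply, h2, smul_eq_mul]
      simp
    rw [← h1, hc, map_zero, LinearMap.zero_apply]
  simpa using hli.fintype_card_le_finrank

/-- Locally uniform decay of the translated forms, for an arbitrary weight in place of a power
of `M(z, x)`. -/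
theorem exists_continuous_formNorm_le (hB : IsBase B) (hH : Hᴴ = -H)
    {z₀ : Matrix (Fin n) (Fin n) B} (hz₀ : z₀ ∈ symmetricSpace H)
    {W : (Fin m → Fin n → B) → ℝ} (hW0 : ∀ y, 0 ≤ W y)
    (hW : ∀ f : 𝓢(Fin m → Fin n → B, ℂ), ∃ C : DualCover H m → ℝ, Continuous C ∧
      ∀ g' y, W y * ‖weil H g' f y‖ ≤ C g') (ψ : SchwartzForm H z₀ m) :
    ∃ C : DualCover H m → ℝ, Continuous C ∧ (∀ g', 0 ≤ C g') ∧
      ∀ (g' : DualCover H m) (z : Matrix (Fin n) (Fin n) B)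
        (g : (Matrix (Fin n) (Fin n) B)ˣ) (hgG : g ∈ isometryGroup H) (hg : act g z₀ = z)
        (N : ℕ) (e : Fin N → tangent H z), IsOrthonormalBasis e →
        ∀ x, W (actTuple g⁻¹ x) * formNorm e (translatedForm ψ g hgG hg g' x) ≤ C g' := by
  -- only the degrees `d ≤ dim 𝔭_{z₀}` occur, and there are at most `2 ^ dim 𝔭_{z₀}` components
  choose C hC hCle using fun d => exists_continuous_form_le hB hH hz₀ hW0 hW (ψ d)
  set N₀ := Module.finrank ℝ (tangent H z₀)
  refine ⟨fun g' => 2 ^ N₀ * ∑ d ∈ Finset.range (N₀ + 1), |C d g'|, ?_, fun g' => by positivity,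
    fun g' z g hgG hg N e he x => ?_⟩
  · exact continuous_const.mul (continuous_finsetSum _ fun d _ => (hC d).abs)
  have hunit : ∀ i j, traceForm (pullTangent g hgG hg (e i)).1 (pullTangent g hgG hg (e j)).1 =
      if i = j then 1 else 0 := fun i j => by rw [traceForm_pullTangent hB, he.1]
  have hN : N ≤ N₀ := le_finrank_of_orthonormal hunit
  set A := ∑ d ∈ Finset.range (N₀ + 1), |C d g'| with hA
  have hA0 : 0 ≤ A := Finset.sum_nonneg fun d _ => abs_nonneg _
  set y := actTuple g⁻¹ x with hy
  have hterm : ∀ s : Finset (Fin N), W y * ‖translatedForm ψ g hgG hg g' x s.card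
      (fun i => e (s.orderEmbOfFin rfl i))‖ ≤ A := by
    intro s
    have h1 := hCle s.card g' y (fun i => pullTangent g hgG hg (e (s.orderEmbOfFin rfl i)))
      (fun i => by rw [hunit, if_pos rfl])
    refine h1.trans ((le_abs_self _).trans ?_)
    have hs : s.card < N₀ + 1 := by
      have := s.card_le_univ
      rw [Fintype.card_fin] at this
      omega
    exact Finset.single_le_sum (f := fun d => |C d g'|) (fun d _ => abs_nonneg _)
      (Finset.mem_range.2 hs)
  have h2 : W y * formNorm e (translatedForm ψ g hgG hg g' x) =
      Real.sqrt (∑ s : Finset (Fin N), (W y * ‖translatedForm ψ g hgG hg g' x s.card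
        (fun i => e (s.orderEmbOfFin rfl i))‖) ^ 2) := by
    simp only [mul_pow, ← Finset.mul_sum]
    rw [Real.sqrt_mul (sq_nonneg _), Real.sqrt_sq (hW0 y)]
    rfl
  rw [h2]
  refine Real.sqrt_le_iff.2 ⟨by positivity, ?_⟩
  calc _ ≤ ∑ s : Finset (Fin N), A ^ 2 := Finset.sum_le_sum fun s _ =>
        pow_le_pow_left₀ (mul_nonneg (hW0 y) (norm_nonneg _)) (hterm s) 2
    _ = 2 ^ N * A ^ 2 := by simp
    _ ≤ (2 ^ N₀) ^ 2 * A ^ 2 := by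
        refine mul_le_mul_of_nonneg_right ?_ (sq_nonneg A)
        rw [← pow_mul]
        exact pow_le_pow_right₀ (by norm_num) (by omega)
    _ = _ := by rw [mul_pow]

end Decay

end CycleDecay

theorem mainTheorem6 {B : Type} [NormedDivisionRing B] [NormedAlgebra ℝ B] [StarRing B]
    [StarModule ℝ B] [FiniteDimensional ℝ B] [RealPart B] (hB : IsBase B) {n m : ℕ}
    (H : Matrix (Fin n) (Fin n) B) (hH : Hᴴ = -H) (hHunit : IsUnit H)
    (x : Fin m → Fin n → B) (U : Submodule Bᵐᵒᵖ (Fin n → B))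
    (hU : U = Submodule.span Bᵐᵒᵖ (Set.range x)) (hUnondeg : Nondegenerate H U)
    (z' : U →ₗ[Bᵐᵒᵖ] U) (hz' : z' ∈ subspaceSymmetricSpace H U) :
    (U ≠ ⊥ → ∃ b c : ℝ, 0 < b ∧ 0 < c ∧
      ∀ z₀ ∈ specialSubspace H U z', ∀ z ∈ symmetricSpace H, ∀ g ∈ isometryGroup H,
        act g z₀ = z →
          c * Real.exp (2 * b * riemDist H (specialSubspace H U z') z) ≤ majorantSum H z₀ g x) ∧
    (∀ z₀ ∈ symmetricSpace H, ∀ ψ : SchwartzForm H z₀ m, IsKInvariant ψ →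
      ∀ ρ : ℝ, 0 < ρ → ∃ C : DualCover H m → ℝ, Continuous C ∧ (∀ g', 0 < C g') ∧
        ∀ (g' : DualCover H m), ∀ z ∈ symmetricSpace H,
          ∀ (g : (Matrix (Fin n) (Fin n) B)ˣ) (hgG : g ∈ isometryGroup H) (hg : act g z₀ = z)
            (N : ℕ) (e : Fin N → tangent H z), IsOrthonormalBasis e →
            formNorm e (translatedForm ψ g hgG hg g' x) ≤
              C g' * Real.exp (-ρ * riemDist H (specialSubspace H U z') z)) := by
  refine ⟨fun hU0 => ?_, fun z₀ hz₀ ψ _ ρ hρ => ?_⟩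
  · obtain ⟨b, c, hb, hc, h⟩ := exists_exp_riemDist_le hB hH x hU hUnondeg hz' hU0
    refine ⟨b, c, hb, hc, fun z₀ _ z hz g hg hgz => ?_⟩
    rw [majorantSum_eq hg hgz]
    exact h z hz
  · have hP := isPositive_of_mem hH hz₀
    obtain ⟨W, κ, hκ, hW0, hW, hWexp⟩ : ∃ (W : (Fin m → Fin n → B) → ℝ) (κ : ℝ), 0 < κ ∧
        (∀ y, 0 ≤ W y) ∧ (∀ f : 𝓢(Fin m → Fin n → B, ℂ), ∃ C : DualCover H m → ℝ, Continuous C ∧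
          ∀ g' y, W y * ‖weil H g' f y‖ ≤ C g') ∧
        ∀ z ∈ symmetricSpace H, ∀ g ∈ isometryGroup H, act g z₀ = z →
          κ * Real.exp (ρ * riemDist H (specialSubspace H U z') z) ≤ W (actTuple g⁻¹ x) := by
      by_cases hU0 : U = ⊥
      · refine ⟨fun _ => 1, 1, one_pos, fun _ => zero_le_one, fun f => ?_, fun z hz g _ _ => ?_⟩
        · simpa [weylWord_nil] using exists_continuous_norm_le hB hHunit [] f
        · rw [riemDist_eq_zero_of_eq_bot hU0 z' hz, mul_zero, Real.exp_zero, one_mul]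
      · obtain ⟨b, c, hb, hc, h⟩ := exists_exp_riemDist_le hB hH x hU hUnondeg hz' hU0
        -- the power of `M(z, x)` that beats the rate `ρ`
        obtain ⟨k, hk⟩ := exists_nat_ge (ρ / (2 * b))
        rw [div_le_iff₀ (by positivity)] at hk
        refine ⟨fun y => (∑ l, reForm (H * z₀) (y l) (y l)) ^ (k + 1), c ^ (k + 1), by positivity,
          fun y => pow_nonneg (Finset.sum_nonneg fun l _ => hP.nonneg _) _,
          exists_continuous_majorant_pow_mul_le hB hHunit hP k, fun z hz g hg hgz => ?_⟩
        have h1 : ∑ l, reForm (H * z₀) (actTuple g⁻¹ x l) (actTuple g⁻¹ x l) =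
            ∑ l, majorant H z (x l) := by
          rw [← majorantSum_eq hg hgz]
          exact Finset.sum_congr rfl fun l _ => (majorant_eq_reForm _ _).symm
        have hd := riemDist_nonneg (H := H) (specialSubspace H U z') z
        change _ ≤ (∑ l, reForm (H * z₀) (actTuple g⁻¹ x l) (actTuple g⁻¹ x l)) ^ (k + 1)
        rw [h1]
        refine le_trans ?_ (pow_le_pow_left₀ (by positivity) (h z hz) (k + 1))
        rw [mul_pow, ← Real.exp_nat_mul]
        refine mul_le_mul_of_nonneg_left (Real.exp_le_exp.2 ?_) (by positivity)
        push_cast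
        nlinarith [mul_nonneg hb.le hd]
    obtain ⟨C, hC, hC0, hCle⟩ := exists_continuous_formNorm_le hB hH hz₀ hW0 hW ψ
    refine ⟨fun g' => C g' / κ + 1, (hC.div_const κ).add continuous_const,
      fun g' => by have := hC0 g'; positivity, fun g' z hz g hgG hg N e he => ?_⟩
    have h1 := hCle g' z g hgG hg N e he x
    have h2 := hWexp z hz g hgG hg
    set D := riemDist H (specialSubspace H U z') z
    set F := formNorm e (translatedForm ψ g hgG hg g' x)
    have hF : 0 ≤ F := Real.sqrt_nonneg _
    have h3 : κ * Real.exp (ρ * D) * F ≤ C g' := (mul_le_mul_of_nonneg_right h2 hF).trans h1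
    rw [neg_mul, Real.exp_neg, ← div_eq_mul_inv, le_div_iff₀ (Real.exp_pos _)]
    have h4 : F * Real.exp (ρ * D) ≤ C g' / κ := by
      rw [le_div_iff₀ hκ]
      linarith
    linarith
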